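/- **Setting.** Let $\mathcal M$ be a (Hausdorff, second countable) smooth manifold of dimension $2D$ with a para-Hermitian structure $(K,g)$: $K\in\mathrm{End}(T\mathcal M)$, $K^2=1$, $g$ a smooth symmetric non-degenerate bilinear form with $g(Ku,Kv)=-g(u,v)$, and such that both eigenbundles $T\mathcal M_\pm$ are integrable, i.e. around each point there are coordinates $(x^\mu,\tilde x_\mu)_{1\le\mu\le D}$ with $T\mathcal M_+=\{d\tilde x=0\}$, $T\mathcal M_-=\{dx=0\}$. Identify $(T\mathcal M_\pm)^*$ with the covectors that vanish on $T\mathcal M_\mp$. *Doubled cotangent paths.* $PT^*\mathcal M$ (resp. $\widetilde{PT^*\mathcal M}$) is the set of smooth paths $(\gamma,\theta):[0,1]\to T^*\mathcal M$ with $\dot\gamma_t\in T\mathcal M_+$, $\theta_t\in(T\mathcal M_+)^*_{\gamma_t}$ (resp. with $-$). $\mathbf{PT}^*\mathcal M$ is the set of pairs $a\diamond\tilde a$ with $a=(\gamma,\theta)\in PT^*\mathcal M$, $\tilde a=(\tilde\gamma,\tilde\theta)\in\widetilde{PT^*\mathcal M}$, $\gamma_1=\tilde\gamma_0$. Source: $\gamma_0$;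 target: $\tilde\gamma_1$; unit at $p$: the constant paths with zero covectors. *Bisections.* A bisection $\Sigma=(\phi,\eta)$ of $PT^*\mathcal M$ is a map assigning to $t\in[0,1]$, $p\in\mathcal M$ a covector $\eta_t(p)$ at $\phi_t(p)$, smooth in $(t,p)$, such that $t\mapsto\eta_t(p)$ lies in $PT^*\mathcal M$, $\phi_0=\mathrm{id}$, $\phi_1$ is a diffeomorphism, and $T\phi_t$ commutes with $K$ (so locally $\phi_t(x,\tilde x)=(\phi_t(x),\tilde x)$); similarly $\tilde\Sigma=(\tilde\phi,\tilde\eta)$ for $\widetilde{PT^*\mathcal M}$. The bisection $\mathbf\Sigma=\Sigma\diamond\tilde\Sigma$ of $\mathbf{PT}^*\mathcal M$ is the set of the doubled paths $\eta(p)\diamond\tilde\eta(\phi_1(p))$, $p\in\mathcal M$. Put $\Phi_{\mathbf\Sigma}=\tilde\phi_1\circ\phi_1$, locally $(x,\tilde x)\mapsto(\phi_1(x),\tilde\phi_1(\tilde x))$, and $$\beta_\Sigma=\int_0^1\phi_s^*\eta_s\,ds,\qquad \tilde\beta_{\tilde\Sigma}=\int_0^1\tilde\phi_s^*\tilde\eta_s\,ds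 ,$$ where $(\phi_s^*\eta_s)_p=\eta_s(p)\circ T_p\phi_s$. Let $\mathrm d$, $\tilde{\mathrm d}$ be the exterior derivatives along $T\mathcal M_+$, $T\mathcal M_-$. *Product.* $\mathbf\Sigma\trianglerighteq(a\diamond\tilde a)=a'\diamond\tilde a'$, where $a'=(\gamma',\theta')$, $\tilde a'=(\tilde\gamma',\tilde\theta')$ are given by $$\gamma'_t=\Phi_{\mathbf\Sigma}(\gamma_t),\quad \theta'_t=(\phi_1^{-1})^*\bigl(\theta_t-\iota_{\dot\gamma_t}\phi_1^*\mathrm d\beta_\Sigma\bigr),\qquad \tilde\gamma'_t=\Phi_{\mathbf\Sigma}(\tilde\gamma_t),\quad \tilde\theta'_t=(\tilde\phi_1^{-1})^*\bigl(\tilde\theta_t-\iota_{\dot{\tilde\gamma}_t}\tilde\phi_1^*\tilde{\mathrm d}\tilde\beta_{\tilde\Sigma}\bigr);$$ here the outer $(\phi_1^{-1})^*$, $(\tilde\phi_1^{-1})^*$ act on fibres in the coordinates $(x,\tilde x)$, that is, they are composition with $(T\Phi_{\mathbf\Sigma})^{-1}$ on $(T\mathcal M_+)^*$, $(T\mathcal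 M_-)^*$. For a bisection $\mathbf T$, $\mathbf\Sigma\trianglerighteq\mathbf T$ is the image of $\mathbf T$ under $\mathbf\Sigma\trianglerighteq(\cdot)$. **Proposition.** (1) For every such $\mathcal M$: $\mathbf{PT}^*\mathcal M\rightrightarrows\mathcal M$ is a precategory (source and target are surjective, and the unit is a section of both); $\Sigma\diamond\tilde\Sigma$ determines $\Sigma$ and $\tilde\Sigma$; the product $\trianglerighteq$ is well defined, and $(\mathbf{PT}^*\mathcal M\rightrightarrows\mathcal M,\trianglerighteq)$ is a pre-rackoid, i.e. on each $\mathbf\Sigma=\Sigma\diamond\tilde\Sigma$ source and target restrict to bijections onto $\mathcal M$, the map $\Phi_{\mathbf\Sigma}$ is smooth, $\mathbf\Sigma\trianglerighteq(\cdot)$ maps a doubled path from $x$ to $y$ to one from $\Phi_{\mathbf\Sigma}(x)$ to $\Phi_{\mathbf\Sigma}(y)$, and $\mathbf\Sigma\trianglerighteq(\cdot):\mathbf{PT}^*\mathcal M\to\mathbf{PT}^*\mathcal M$ is bijective. Moreover, for $\mathbf T=(\psi,\zeta)\diamond(\tilde\psi,\tilde\zeta)$, the set $\mathbf\Sigma\trianglerighteq\mathbf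 T$ is again a bisection of this form, with base paths $\phi_1\circ\psi_t\circ\phi_1^{-1}$ and $\tilde\phi_1\circ\tilde\psi_t\circ\tilde\phi_1^{-1}$. (2) The product is not self-distributive in general: for every $D\ge2$ there is such a manifold $\mathcal M$ of dimension $2D$ with bisections $\mathbf\Sigma,\mathbf T$ and a doubled cotangent path $g$ such that $\mathbf\Sigma\trianglerighteq(\mathbf T\trianglerighteq g)\neq(\mathbf\Sigma\trianglerighteq\mathbf T)\trianglerighteq(\mathbf\Sigma\trianglerighteq g)$. -/

import Mathlib

open Set Manifold Bundle
open scoped ContDiff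

attribute [-instance] TopCat.of.chartedSpace TopCat.of.hasGroupoid

noncomputable section

/-! ### Semi-precategories, bisections and pre-rackoids -/

/-- Surjective source and target maps together with a unit map. -/
structure IsPrecategory {G M : Type*} (s t : G → M) (unit : M → G) : Prop where
  source_surjective : Function.Surjective s
  target_surjective : Function.Surjective t
  source_unit : ∀ x, s (unit x) = x
  target_unit : ∀ x, t (unit x) = x

/-- A bisection: a subset on which source and target both restrict to bijections onto `M`. -/
def IsBisection {G M : Type*} (s t : G → M) (A : Set G) : Prop :=
  BijOn s A univ ∧ BijOn t A univ

/-- The coordinate space `ℝ^D × ℝ^D` with coordinates `(x, x̃)`. -/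
abbrev DoubledSpace (D : ℕ) : Type := EuclideanSpace ℝ (Fin D) × EuclideanSpace ℝ (Fin D)

/-- `B` is the type of (smooth) bisections, `carrier Σ` is the subset of `G` underlying `Σ`,
`dot Σ x` is the action `Σ · x` of a bisection on the points of the base manifold, and
`act Σ g` is `Σ ⊵ g`. -/
structure IsPreRackoid (D : ℕ) {G M B : Type*} [TopologicalSpace M]
    [ChartedSpace (DoubledSpace D) M]
    (s t : G → M) (carrier : B → Set G) (dot : B → M → M) (act : B → G → G) : Prop where
  source_surjective : Function.Surjective s
  target_surjective : Function.Surjective t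
  isBisection : ∀ σ, IsBisection s t (carrier σ)
  dot_smooth : ∀ σ, ContMDiff 𝓘(ℝ, DoubledSpace D) 𝓘(ℝ, DoubledSpace D) ∞ (dot σ)
  source_act : ∀ σ g, s (act σ g) = dot σ (s g)
  target_act : ∀ σ g, t (act σ g) = dot σ (t g)
  bijective : ∀ σ, Function.Bijective (act σ)

/-- `Σ ⊵ (T ⊵ g) = (Σ ⊵ T) ⊵ (Σ ⊵ g)`, where `Σ ⊵ T` is the bisection whose underlying set is
the image of `T` under `Σ ⊵ ·`. -/
def SelfDistributive {G B : Type*} (carrier : B → Set G) (act : B → G → G) : Prop :=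
  ∀ σ τ υ : B, carrier υ = act σ '' carrier τ →
    ∀ g : G, act σ (act τ g) = act υ (act σ g)

/-! ### Para-Hermitian manifolds with doubled foliations -/

/-- The standard para-complex structure `(x, x̃) ↦ (x, -x̃)`. -/
def stdParaComplex (D : ℕ) : DoubledSpace D →L[ℝ] DoubledSpace D :=
  (ContinuousLinearMap.fst ℝ _ _).prod (-ContinuousLinearMap.snd ℝ _ _)

/-- A para-Hermitian structure on a `2D`-dimensional manifold, whose two eigenbundles are both
integrable.  Integrability is the existence of local coordinates `(x, x̃)` in which the leaves of
the `+1` foliation are `x̃ = const` and those of the `-1` foliation are `x = const`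
(this also gives the smoothness of `K` and the rank `D` of both eigenbundles).
The metric is automatically neutral. -/
structure ParaHermitian (D : ℕ) (M : Type*) [TopologicalSpace M]
    [ChartedSpace (DoubledSpace D) M] [IsManifold 𝓘(ℝ, DoubledSpace D) ∞ M] where
  K : ∀ p : M, TangentSpace 𝓘(ℝ, DoubledSpace D) p →L[ℝ] TangentSpace 𝓘(ℝ, DoubledSpace D) p
  K_sq : ∀ p v, K p (K p v) = v
  metric : ∀ p : M, TangentSpace 𝓘(ℝ, DoubledSpace D) p →L[ℝ]
    TangentSpace 𝓘(ℝ, DoubledSpace D) p →L[ℝ] ℝ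
  metric_smooth : ContMDiff 𝓘(ℝ, DoubledSpace D)
    (𝓘(ℝ, DoubledSpace D).prod 𝓘(ℝ, DoubledSpace D →L[ℝ] DoubledSpace D →L[ℝ] ℝ)) ∞
    (fun p => TotalSpace.mk' (DoubledSpace D →L[ℝ] DoubledSpace D →L[ℝ] ℝ) p (metric p))
  metric_symm : ∀ p u v, metric p u v = metric p v u
  metric_nondegenerate : ∀ p u, (∀ v, metric p u v = 0) → u = 0
  metric_K : ∀ p u v, metric p (K p u) (K p v) = - metric p u v
  doubled_foliations : ∀ p : M, ∃ e ∈ IsManifold.maximalAtlas 𝓘(ℝ, DoubledSpace D) ∞ M,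
    p ∈ e.source ∧ ∀ q ∈ e.source, ∀ v : TangentSpace 𝓘(ℝ, DoubledSpace D) q,
      mfderiv 𝓘(ℝ, DoubledSpace D) 𝓘(ℝ, DoubledSpace D) e q (K q v) =
        stdParaComplex D (mfderiv 𝓘(ℝ, DoubledSpace D) 𝓘(ℝ, DoubledSpace D) e q v)

section

variable {D : ℕ} {M : Type*} [TopologicalSpace M] [ChartedSpace (DoubledSpace D) M]

/-- The cotangent bundle `T*M`. -/
abbrev Cotangent (D : ℕ) (M : Type*) [TopologicalSpace M] [ChartedSpace (DoubledSpace D) M] :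
    Type _ :=
  TotalSpace (DoubledSpace D →L[ℝ] ℝ)
    (fun p : M => TangentSpace 𝓘(ℝ, DoubledSpace D) p →L[ℝ] ℝ)

/-- Exterior derivative of a 1-form `β` on `M`, computed in the preferred chart at `p`:
`dβ(u, v) = D_u b (v) - D_v b (u)` for the coordinate expression `b` of `β`. -/
def extD (β : ∀ p : M, TangentSpace 𝓘(ℝ, DoubledSpace D) p →L[ℝ] ℝ) (p : M)
    (u v : TangentSpace 𝓘(ℝ, DoubledSpace D) p) : ℝ :=
  let e := extChartAt 𝓘(ℝ, DoubledSpace D) p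
  let b : DoubledSpace D → (DoubledSpace D →L[ℝ] ℝ) := fun y =>
    (β (e.symm y)).comp (mfderiv 𝓘(ℝ, DoubledSpace D) 𝓘(ℝ, DoubledSpace D) e.symm y)
  let A : DoubledSpace D →L[ℝ] DoubledSpace D :=
    mfderiv 𝓘(ℝ, DoubledSpace D) 𝓘(ℝ, DoubledSpace D) e p
  fderiv ℝ b (e p) (A u) (A v) - fderiv ℝ b (e p) (A v) (A u)

/-- The velocity at time `t` of a path `[0,1] → M` (one-sided at the end points). -/
def velocity (γ : unitInterval → M) (t : unitInterval) : TangentSpace 𝓘(ℝ, DoubledSpace D) (γ t) :=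
  (mfderivWithin 𝓘(ℝ, ℝ) 𝓘(ℝ, DoubledSpace D) (IccExtend zero_le_one γ) (Icc 0 1) (t : ℝ) :
    ℝ →L[ℝ] DoubledSpace D) 1

variable [IsManifold 𝓘(ℝ, DoubledSpace D) ∞ M]

/-- Smooth cotangent paths along the leaves of one of the two foliations: `ε = 1` gives the paths
`(γ, θ)` with `γ` tangent to `TM₊` and `θ` in `(TM₊)*`, `ε = -1` those for `TM₋`.  Here `(TM₊)*` is
the subbundle of `T*M` of the covectors that vanish on `TM₋`, and vice versa. -/
structure IsLeafPath (S : ParaHermitian D M) (ε : ℝ) (c : unitInterval → Cotangent D M) : Prop where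
  smooth : ContMDiffOn 𝓘(ℝ, ℝ) (𝓘(ℝ, DoubledSpace D).prod 𝓘(ℝ, DoubledSpace D →L[ℝ] ℝ)) ∞
    (IccExtend zero_le_one c) (Icc 0 1)
  tangent : ∀ t, S.K (c t).proj (velocity (fun t => (c t).proj) t) =
    ε • velocity (fun t => (c t).proj) t
  covector : ∀ t v, (c t).snd (S.K (c t).proj v) = ε * (c t).snd v

/-- A doubled cotangent path: a cotangent path along a leaf of the `+` foliation, concatenated with
a cotangent path along the leaf of the `-` foliation through its end point. -/
structure DoubledCotangentPath (S : ParaHermitian D M) where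
  fst : unitInterval → Cotangent D M
  snd : unitInterval → Cotangent D M
  fst_isLeafPath : IsLeafPath S 1 fst
  snd_isLeafPath : IsLeafPath S (-1) snd
  concat : (fst 1).proj = (snd 0).proj

/-- The source of a doubled path is the source of its first part. -/
def DoubledCotangentPath.source {S : ParaHermitian D M} (g : DoubledCotangentPath S) : M :=
  (g.fst 0).proj

/-- The target of a doubled path is the target of its second part. -/
def DoubledCotangentPath.target {S : ParaHermitian D M} (g : DoubledCotangentPath S) : M :=
  (g.snd 1).proj

/-- A smooth bisection `(φ, η)` of the cotangent paths along one of the foliations.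
`η t p` is a covector at `φ_t(p)`; `φ_0 = id`, `φ_1` is a diffeomorphism, every `t ↦ η t p` is a
cotangent path along a leaf, and `φ_t` respects both foliations, that is, in coordinates
`φ_t(x, x̃) = (φ_t(x), x̃)` for `ε = 1` and `φ_t(x, x̃) = (x, φ_t(x̃))` for `ε = -1`. -/
structure LeafBisection (S : ParaHermitian D M) (ε : ℝ) where
  η : unitInterval → M → Cotangent D M
  smooth : ContMDiffOn (𝓘(ℝ, ℝ).prod 𝓘(ℝ, DoubledSpace D))
    (𝓘(ℝ, DoubledSpace D).prod 𝓘(ℝ, DoubledSpace D →L[ℝ] ℝ)) ∞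
    (fun q : ℝ × M => IccExtend zero_le_one η q.1 q.2) (Icc 0 1 ×ˢ univ)
  isLeafPath : ∀ p, IsLeafPath S ε (fun t => η t p)
  zero : ∀ p, (η 0 p).proj = p
  one_diffeo : ∃ f : Diffeomorph 𝓘(ℝ, DoubledSpace D) 𝓘(ℝ, DoubledSpace D) M M ∞,
    ∀ p, f p = (η 1 p).proj
  foliated : ∀ t p v,
    mfderiv 𝓘(ℝ, DoubledSpace D) 𝓘(ℝ, DoubledSpace D) (fun q => (η t q).proj) p (S.K p v) =
      S.K (η t p).proj
        (mfderiv 𝓘(ℝ, DoubledSpace D) 𝓘(ℝ, DoubledSpace D) (fun q => (η t q).proj) p v)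

namespace LeafBisection

variable {S : ParaHermitian D M} {ε : ℝ}

/-- The base path `φ_t : M → M`. -/
def φ (σ : LeafBisection S ε) (t : unitInterval) (p : M) : M := (σ.η t p).proj

/-- The 1-form `β_Σ = ∫₀¹ φ_s^* η_s ds`. -/
def β (σ : LeafBisection S ε) (p : M) : TangentSpace 𝓘(ℝ, DoubledSpace D) p →L[ℝ] ℝ :=
  (∫ s in (0 : ℝ)..1, IccExtend zero_le_one (fun s : unitInterval =>
    (((σ.η s p).snd.comp
      (mfderiv 𝓘(ℝ, DoubledSpace D) 𝓘(ℝ, DoubledSpace D) (σ.φ s) p) :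
        DoubledSpace D →L[ℝ] ℝ))) s : DoubledSpace D →L[ℝ] ℝ)

/-- The projection of `TM` onto the eigenbundle of `K` with eigenvalue `ε = ±1`. -/
def eigenProj (S : ParaHermitian D M) (ε : ℝ) (p : M)
    (v : TangentSpace 𝓘(ℝ, DoubledSpace D) p) : TangentSpace 𝓘(ℝ, DoubledSpace D) p :=
  (2⁻¹ : ℝ) • (v + ε • S.K p v)

/-- The 2-form `φ_1^* d β_Σ` at `q`, where `d` is the exterior derivative along the leaves
(`d = dx^μ ∧ ∂_μ` for `ε = 1`, and `d̃` for `ε = -1`). -/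
def curv (σ : LeafBisection S ε) (q : M) (u v : TangentSpace 𝓘(ℝ, DoubledSpace D) q) : ℝ :=
  extD σ.β (σ.φ 1 q)
    (eigenProj S ε _ (mfderiv 𝓘(ℝ, DoubledSpace D) 𝓘(ℝ, DoubledSpace D) (σ.φ 1) q u))
    (eigenProj S ε _ (mfderiv 𝓘(ℝ, DoubledSpace D) 𝓘(ℝ, DoubledSpace D) (σ.φ 1) q v))

end LeafBisection

/-- A bisection `Σ ⋄ Σ̃` of the doubled cotangent paths. -/
structure DoubledBisection (S : ParaHermitian D M) where
  fst : LeafBisection S 1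
  snd : LeafBisection S (-1)

namespace DoubledBisection

variable {S : ParaHermitian D M}

/-- The diffeomorphism `(x, x̃) ↦ (φ_1(x), φ̃_1(x̃))` underlying `Σ ⋄ Σ̃`. -/
def dot (σ : DoubledBisection S) (p : M) : M := σ.snd.φ 1 (σ.fst.φ 1 p)

/-- The doubled path of `Σ ⋄ Σ̃` which starts at `p`. -/
def path (σ : DoubledBisection S) (p : M) : DoubledCotangentPath S where
  fst := fun t => σ.fst.η t p
  snd := fun t => σ.snd.η t (σ.fst.φ 1 p)
  fst_isLeafPath := σ.fst.isLeafPath p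
  snd_isLeafPath := σ.snd.isLeafPath _
  concat := (σ.snd.zero _).symm

/-- `Σ ⋄ Σ̃` as a set of doubled cotangent paths. -/
def carrier (σ : DoubledBisection S) : Set (DoubledCotangentPath S) := range σ.path

end DoubledBisection

/-- `c'` is obtained from the cotangent path `c = (γ, θ)` along a leaf by
`γ'_t = Φ(γ_t)` and `θ'_t = (θ_t - ι_{γ̇_t} φ_1^* d β_Σ) ∘ (TΦ)⁻¹`.  When `Φ` is the diffeomorphism
`(x, x̃) ↦ (φ_1(x), φ̃_1(x̃))`, the map `θ ↦ θ ∘ (TΦ)⁻¹` is `(φ_1⁻¹)^*` on `(TM₊)*` and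
`(φ̃_1⁻¹)^*` on `(TM₋)*`. -/
def IsRackTransform {S : ParaHermitian D M} {ε : ℝ} (σ : LeafBisection S ε) (Φ : M → M)
    (c c' : unitInterval → Cotangent D M) : Prop :=
  ∀ t, ∃ θ' : TangentSpace 𝓘(ℝ, DoubledSpace D) (Φ (c t).proj) →L[ℝ] ℝ,
    c' t = ⟨Φ (c t).proj, θ'⟩ ∧
    ∀ v, θ' (mfderiv 𝓘(ℝ, DoubledSpace D) 𝓘(ℝ, DoubledSpace D) Φ (c t).proj v) =
      (c t).snd v - σ.curv (c t).proj (velocity (fun t => (c t).proj) t) v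

/-- `act` is the product `⊵` of doubled bisections with doubled cotangent paths. -/
def IsDoubledProduct (S : ParaHermitian D M)
    (act : DoubledBisection S → DoubledCotangentPath S → DoubledCotangentPath S) : Prop :=
  ∀ σ g, IsRackTransform σ.fst σ.dot g.fst (act σ g).fst ∧
    IsRackTransform σ.snd σ.dot g.snd (act σ g).snd

theorem isLeafPath_const (S : ParaHermitian D M) (ε : ℝ) (p : M) :
    IsLeafPath S ε (fun _ => (⟨p, 0⟩ : Cotangent D M)) where
  smooth := by
    have : IccExtend zero_le_one (fun _ : unitInterval => (⟨p, 0⟩ : Cotangent D M)) = fun _ => ⟨p, 0⟩ := rfl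
    rw [this]
    exact contMDiffOn_const
  tangent t := by
    have h : velocity (D := D) (fun _ : unitInterval => p) t = 0 := by
      have : IccExtend zero_le_one (fun _ : unitInterval => p) = fun _ => p := rfl
      unfold velocity
      rw [this, mfderivWithin_const]
      rfl
    show S.K p (velocity (fun _ : unitInterval => p) t) = ε • velocity (fun _ : unitInterval => p) t
    rw [h, map_zero, smul_zero]
  covector t v := by simp

/-- The unit at `p`: constant paths with zero covectors. -/
def DoubledCotangentPath.unit (S : ParaHermitian D M) (p : M) : DoubledCotangentPath S where
  fst := fun _ => ⟨p, 0⟩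
  snd := fun _ => ⟨p, 0⟩
  fst_isLeafPath := isLeafPath_const S 1 p
  snd_isLeafPath := isLeafPath_const S (-1) p
  concat := rfl

end

end

/-!
# The pre-rackoid of doubled cotangent paths

*The product is bijective.* A doubled bisection acts on each half of a doubled path by a *shear*:
the base path is moved by the diffeomorphism `Φ = φ̃₁ ∘ φ₁`, the covectors are transported along
`TΦ`, and the contraction of the velocity with a leafwise 2-form is added (`shear`). The inverse is
again a shear, along `Φ⁻¹` and with the opposite of the pulled back 2-form
(`IsLeafPath.shear_symm_shear`), and the product is determined by its defining equation because
`TΦ` is invertible. What has to be checked is that shears preserve smooth leafwise cotangent paths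
(`IsLeafPath.shear`). Compatibility with `K` is formal; smoothness reduces to that of the form
`φ₁^* d β`. There `β` is a parametric integral of smooth functions over `[0, 1]`
(`contDiffOn_integral`), and `d β`, which is defined at each point through the preferred chart at
that point, may be computed near a point in one fixed chart, because the second derivative of a
change of charts is symmetric (`extDer_eq`). The field `K` itself is smooth since it is constant in
foliated charts (`ParaHermitian.smoothHom_Kmap`).

*The image of a bisection.* Shearing all paths of a bisection `T` gives a bisection whose base
paths are conjugated by `Φ` (`DoubledBisection.image`). That they are conjugated by `φ₁`,
respectively `φ̃₁`, alone amounts to the commutation of bisections along the two foliations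
(`LeafBisection.φ_comm`). Both `φ_t (φ̃_s p)` and `φ̃_s (φ_t p)` are rectangles whose
horizontal and vertical lines are tangent to the two foliations. In a foliated chart such a
rectangle has the form `(x(t), x̃(s))`, so that it is determined by two adjacent sides; a
subdivision of the square into small squares gives the same globally
(`IsLeafRectangle.eq_of_sides`). The Hausdorff property is needed here: it makes the set on which
two rectangles differ open.

*Self-distributivity fails* in the flat space, for bisections which are linear in the point. The
covectors of `Σ ⊵ T` are read off from the form of `Σ` along the base paths of `T`, but they give
rise to a form of `Σ ⊵ T` of their own, and so to a term which the other side of the law does not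
have. With `ω = dx^0 ∧ dx^1`, let `Σ` fix all points with form `ω`, and let `T` be the scaling
`x ↦ (1 + t) x` with zero covectors. Then `Σ ⊵ T` is the scaling with covectors `-ω(p, ·)` and form
`-12 ω`, and on the straight line from the origin to a basis vector `e_0` the two sides of the law
have the covectors `-2 ω(e_0, ·)` and `(11/2) ω(e_0, ·)` (`not_selfDistributive`).
-/

noncomputable section

/-! ### Tangent maps and covector fields in charts -/

section TangentCoordinates

variable {E : Type*} [NormedAddCommGroup E] [NormedSpace ℝ E]
  {M : Type*} [TopologicalSpace M] [ChartedSpace E M]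
  {M' : Type*} [TopologicalSpace M'] [ChartedSpace E M']
  {M'' : Type*} [TopologicalSpace M''] [ChartedSpace E M'']

variable (E) in
/-- The derivative of `f` at `p`. The tangent spaces are by definition copies of the model space
`E`, and here they are read as `E`, so that maps at different points have the same type. -/
def tmap (f : M → M') (p : M) : E →L[ℝ] E := mfderiv 𝓘(ℝ, E) 𝓘(ℝ, E) f p

theorem tmap_comp {g : M' → M''} {f : M → M'} {p : M}
    (hg : MDifferentiableAt 𝓘(ℝ, E) 𝓘(ℝ, E) g (f p))
    (hf : MDifferentiableAt 𝓘(ℝ, E) 𝓘(ℝ, E) f p) :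
    tmap E (fun q => g (f q)) p = (tmap E g (f p)).comp (tmap E f p) :=
  mfderiv_comp p hg hf

theorem tmap_congr {f g : M → M'} {p : M} (h : f =ᶠ[nhds p] g) : tmap E f p = tmap E g p :=
  h.mfderiv_eq

theorem tmap_id (p : M) : tmap E (fun q : M => q) p = ContinuousLinearMap.id ℝ E :=
  mfderiv_id

theorem tmap_eq_fderiv (f : E → E) (p : E) : tmap E f p = fderiv ℝ f p := mfderiv_eq_fderiv

variable {EN : Type*} [NormedAddCommGroup EN] [NormedSpace ℝ EN] {HN : Type*} [TopologicalSpace HN]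
  {J : ModelWithCorners ℝ EN HN} {N : Type*} [TopologicalSpace N] [ChartedSpace HN N]
  {s : Set N} {x₀ : N}

/-- Along a map which is continuous at `x₀`, the chart around the image of `x₀` stays available. -/
theorem eventually_mem_chart_source {g : N → M} (hg : ContMDiffWithinAt J 𝓘(ℝ, E) ∞ g s x₀) :
    ∀ᶠ x in nhdsWithin x₀ s, g x ∈ (chartAt E (g x₀)).source :=
  hg.continuousWithinAt.eventually ((chartAt E (g x₀)).open_source.mem_nhds (mem_chart_source E _))

theorem ContMDiffWithinAt.congr_eventually {F : Type*} [NormedAddCommGroup F] [NormedSpace ℝ F]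
    {f f' : N → F} (hf : ContMDiffWithinAt J 𝓘(ℝ, F) ∞ f s x₀)
    (h : ∀ᶠ x in nhdsWithin x₀ s, f' x = f x) (h₀ : f' x₀ = f x₀) :
    ContMDiffWithinAt J 𝓘(ℝ, F) ∞ f' s x₀ :=
  hf.congr_of_eventuallyEq h h₀

variable [IsManifold 𝓘(ℝ, E) 1 M] [IsManifold 𝓘(ℝ, E) 1 M'] [IsManifold 𝓘(ℝ, E) 1 M'']

variable (E) in
/-- The derivative at `p` of the chart around `p₀`. -/
def toChart (p₀ p : M) : E →L[ℝ] E :=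
  (trivializationAt E (TangentSpace 𝓘(ℝ, E) : M → Type _) p₀).continuousLinearMapAt ℝ p

variable (E) in
/-- The inverse of `toChart E p₀ p`, for `p` in the domain of the chart around `p₀`. -/
def fromChart (p₀ p : M) : E →L[ℝ] E :=
  (trivializationAt E (TangentSpace 𝓘(ℝ, E) : M → Type _) p₀).symmL ℝ p

theorem fromChart_toChart {p₀ p : M} (h : p ∈ (chartAt E p₀).source) (v : E) :
    fromChart E p₀ p (toChart E p₀ p v) = v :=
  (trivializationAt E (TangentSpace 𝓘(ℝ, E) : M → Type _) p₀).symmL_continuousLinearMapAt h v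

theorem toChart_fromChart {p₀ p : M} (h : p ∈ (chartAt E p₀).source) (v : E) :
    toChart E p₀ p (fromChart E p₀ p v) = v :=
  (trivializationAt E (TangentSpace 𝓘(ℝ, E) : M → Type _) p₀).continuousLinearMapAt_symmL h v

theorem toChart_eq_tmap {p₀ p : M} (h : p ∈ (chartAt E p₀).source) :
    toChart E p₀ p = tmap E (extChartAt 𝓘(ℝ, E) p₀) p :=
  TangentBundle.continuousLinearMapAt_trivializationAt h

theorem fromChart_eq_tmap {p₀ p : M} (h : p ∈ (chartAt E p₀).source) :
    fromChart E p₀ p = tmap E (extChartAt 𝓘(ℝ, E) p₀).symm (extChartAt 𝓘(ℝ, E) p₀ p) := by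
  have := TangentBundle.symmL_trivializationAt (I := 𝓘(ℝ, E)) h
  rw [ModelWithCorners.range_eq_univ, mfderivWithin_univ] at this
  exact this

theorem fromChart_model (p₀ p : E) : fromChart E p₀ p = ContinuousLinearMap.id ℝ E :=
  TangentBundle.symmL_model_space p₀ p

variable (J) in
/-- A family of covectors `θ x` at the points `g x`, depending smoothly on `x`. -/
structure SmoothCov (g : N → M) (θ : N → E →L[ℝ] ℝ) (s : Set N) (x₀ : N) : Prop where
  base : ContMDiffWithinAt J 𝓘(ℝ, E) ∞ g s x₀
  coord : ContMDiffWithinAt J 𝓘(ℝ, E →L[ℝ] ℝ) ∞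
    (fun x => (θ x).comp (fromChart E (g x₀) (g x))) s x₀

variable (J) in
/-- A family of tangent vectors `u x` at the points `g x`, depending smoothly on `x`. -/
structure SmoothVec (g : N → M) (u : N → E) (s : Set N) (x₀ : N) : Prop where
  base : ContMDiffWithinAt J 𝓘(ℝ, E) ∞ g s x₀
  coord : ContMDiffWithinAt J 𝓘(ℝ, E) ∞ (fun x => toChart E (g x₀) (g x) (u x)) s x₀

variable (J) in
/-- A family of linear maps `L x` from the tangent space at `g x` to the tangent space at `h x`,
depending smoothly on `x`. -/
structure SmoothHom (g : N → M) (h : N → M') (L : N → E →L[ℝ] E) (s : Set N) (x₀ : N) : Prop where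
  base : ContMDiffWithinAt J 𝓘(ℝ, E) ∞ g s x₀
  base' : ContMDiffWithinAt J 𝓘(ℝ, E) ∞ h s x₀
  coord : ContMDiffWithinAt J 𝓘(ℝ, E →L[ℝ] E) ∞
    (fun x => (toChart E (h x₀) (h x)).comp ((L x).comp (fromChart E (g x₀) (g x)))) s x₀

/-- Smoothness of a map into the cotangent bundle, in terms of its base map and its covectors. -/
theorem contMDiffWithinAt_cotangent
    {c : N → TotalSpace (E →L[ℝ] ℝ) (fun p : M => TangentSpace 𝓘(ℝ, E) p →L[ℝ] ℝ)} :
    ContMDiffWithinAt J (𝓘(ℝ, E).prod 𝓘(ℝ, E →L[ℝ] ℝ)) ∞ c s x₀ ↔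
      SmoothCov J (fun x => (c x).proj) (fun x => (c x).snd) s x₀ := by
  rw [contMDiffWithinAt_hom_bundle]
  have : ∀ x, ContinuousLinearMap.inCoordinates E (TangentSpace 𝓘(ℝ, E) : M → Type _) ℝ
      (fun _ : M => ℝ) (c x₀).proj (c x).proj (c x₀).proj (c x).proj (c x).snd =
      ContinuousLinearMap.comp (show E →L[ℝ] ℝ from (c x).snd)
          (fromChart E (c x₀).proj (c x).proj) := by
    intro x
    unfold ContinuousLinearMap.inCoordinates
    erw [Trivial.continuousLinearMapAt_trivialization]
    rfl
  simp_rw [this]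
  exact ⟨fun h => ⟨h.1, h.2⟩, fun h => ⟨h.1, h.2⟩⟩

namespace SmoothCov

variable {g : N → M} {h : N → M'} {θ θ' : N → E →L[ℝ] ℝ} {L : N → E →L[ℝ] E}

theorem add (hθ : SmoothCov J g θ s x₀) (hθ' : SmoothCov J g θ' s x₀) :
    SmoothCov J g (fun x => θ x + θ' x) s x₀ :=
  ⟨hθ.base, (hθ.coord.add hθ'.coord).congr_eventually
    (.of_forall fun _ => ContinuousLinearMap.add_comp _ _ _) (ContinuousLinearMap.add_comp _ _ _)⟩

theorem comp {θ : N → E →L[ℝ] ℝ} (hθ : SmoothCov J h θ s x₀) (hL : SmoothHom J g h L s x₀) :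
    SmoothCov J g (fun x => (θ x).comp (L x)) s x₀ := by
  refine ⟨hL.base, (hθ.coord.clm_comp hL.coord).congr_eventually ?_ ?_⟩
  · filter_upwards [eventually_mem_chart_source hθ.base] with x hx
    ext v
    simp [fromChart_toChart hx]
  · ext v
    simp [fromChart_toChart (mem_chart_source E _)]

end SmoothCov

namespace SmoothHom

variable {g : N → M} {h : N → M'} {k : N → M''} {L L' : N → E →L[ℝ] E}

theorem comp (hL' : SmoothHom J h k L' s x₀) (hL : SmoothHom J g h L s x₀) :
    SmoothHom J g k (fun x => (L' x).comp (L x)) s x₀ := by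
  refine ⟨hL.base, hL'.base', (hL'.coord.clm_comp hL.coord).congr_eventually ?_ ?_⟩
  · filter_upwards [eventually_mem_chart_source hL.base'] with x hx
    ext v
    simp [fromChart_toChart hx]
  · ext v
    simp [fromChart_toChart (mem_chart_source E _)]

theorem add (hL : SmoothHom J g h L s x₀) (hL' : SmoothHom J g h L' s x₀) :
    SmoothHom J g h (fun x => L x + L' x) s x₀ :=
  ⟨hL.base, hL.base', (hL.coord.add hL'.coord).congr_eventually
    (.of_forall fun x => by simp) (by simp)⟩

theorem const_smul (c : ℝ) (hL : SmoothHom J g h L s x₀) :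
    SmoothHom J g h (fun x => c • L x) s x₀ :=
  ⟨hL.base, hL.base',
    ((contMDiffWithinAt_const (I' := 𝓘(ℝ, ℝ)) (c := c)).smul hL.coord).congr_eventually
    (.of_forall fun x => by simp) (by simp)⟩

theorem id (hg : ContMDiffWithinAt J 𝓘(ℝ, E) ∞ g s x₀) :
    SmoothHom J g g (fun _ => ContinuousLinearMap.id ℝ E) s x₀ := by
  refine ⟨hg, hg, (contMDiffWithinAt_const (c := ContinuousLinearMap.id ℝ E)).congr_eventually ?_ ?_⟩
  · filter_upwards [eventually_mem_chart_source hg] with x hx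
    ext v
    simp [toChart_fromChart hx]
  · ext v
    simp [toChart_fromChart (mem_chart_source E _)]

/-- Smoothness of a family of linear maps only depends on its germ. -/
theorem congr {g' : N → M} {h' : N → M'} (hL : SmoothHom J g h L s x₀)
    (H : ∀ᶠ x in nhdsWithin x₀ s, g' x = g x ∧ h' x = h x ∧ L' x = L x)
    (H₀ : g' x₀ = g x₀ ∧ h' x₀ = h x₀ ∧ L' x₀ = L x₀) : SmoothHom J g' h' L' s x₀ := by
  refine ⟨hL.base.congr_of_eventuallyEq (H.mono fun x hx => hx.1) H₀.1,
    hL.base'.congr_of_eventuallyEq (H.mono fun x hx => hx.2.1) H₀.2.1,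
    hL.coord.congr_eventually ?_ ?_⟩
  · filter_upwards [H] with x hx
    rw [hx.1, hx.2.1, hx.2.2, H₀.1, H₀.2.1]
  · rw [H₀.1, H₀.2.1, H₀.2.2]

variable [IsManifold J 1 N]

/-- The derivatives of a smooth family of maps form a smooth family of linear maps. -/
theorem tmap {G : N → M → M'} {g : N → M}
    (hG : ContMDiffWithinAt (J.prod 𝓘(ℝ, E)) 𝓘(ℝ, E) ∞ (fun z : N × M => G z.1 z.2)
      (s ×ˢ univ) (x₀, g x₀))
    (hg : ContMDiffWithinAt J 𝓘(ℝ, E) ∞ g s x₀) (hx₀ : x₀ ∈ s) :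
    SmoothHom J g (fun x => G x (g x)) (fun x => tmap E (G x) (g x)) s x₀ := by
  refine ⟨hg, ?_, ?_⟩
  · exact hG.comp (f := fun x => (x, g x)) x₀ (contMDiffWithinAt_id.prodMk hg)
      (fun x hx => ⟨hx, mem_univ _⟩)
  · have := ContMDiffWithinAt.mfderivWithin (f := G) (m := ∞) hG hg hx₀ (mapsTo_univ _ _) le_rfl
      uniqueMDiffOn_univ
    simp only [mfderivWithin_univ] at this
    exact this

/-- The derivative of a single smooth map, along a smooth family of points. -/
theorem tmap_const {G : M → M'} {g : N → M} (hG : ContMDiffAt 𝓘(ℝ, E) 𝓘(ℝ, E) ∞ G (g x₀))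
    (hg : ContMDiffWithinAt J 𝓘(ℝ, E) ∞ g s x₀) (hx₀ : x₀ ∈ s) :
    SmoothHom J g (fun x => G (g x)) (fun x => _root_.tmap E G (g x)) s x₀ :=
  tmap (G := fun _ => G) (hG.comp_contMDiffWithinAt (x₀, g x₀) contMDiffWithinAt_snd) hg hx₀

end SmoothHom

end TangentCoordinates

/-! ### Smooth bilinear forms and the exterior derivative -/

section Forms

variable {E : Type*} [NormedAddCommGroup E] [NormedSpace ℝ E]
  {M : Type*} [TopologicalSpace M] [ChartedSpace E M] [IsManifold 𝓘(ℝ, E) ∞ M]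
  {M' : Type*} [TopologicalSpace M'] [ChartedSpace E M'] [IsManifold 𝓘(ℝ, E) ∞ M']
  {EN : Type*} [NormedAddCommGroup EN] [NormedSpace ℝ EN] {HN : Type*} [TopologicalSpace HN]
  {J : ModelWithCorners ℝ EN HN} {N : Type*} [TopologicalSpace N] [ChartedSpace HN N]
  {s : Set N} {x₀ : N}

/-- A field of bilinear forms on the tangent spaces of `M` which is smooth in charts. -/
def SmoothForm (Ω : M → E →L[ℝ] E →L[ℝ] ℝ) : Prop :=
  ∀ p₀, ContMDiffAt 𝓘(ℝ, E) 𝓘(ℝ, E →L[ℝ] E →L[ℝ] ℝ) ∞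
    (fun p => (Ω p).bilinearComp (fromChart E p₀ p) (fromChart E p₀ p)) p₀

theorem contDiff_flip : ContDiff ℝ ∞ (fun B : E →L[ℝ] E →L[ℝ] ℝ => B.flip) := by
  refine IsBoundedLinearMap.contDiff ⟨⟨fun _ _ => rfl, fun _ _ => rfl⟩, 1, one_pos, fun B => ?_⟩
  rw [ContinuousLinearMap.opNorm_flip, one_mul]

theorem ContMDiffWithinAt.clm_bilinearComp {B : N → E →L[ℝ] E →L[ℝ] ℝ} {A : N → E →L[ℝ] E}
    (hB : ContMDiffWithinAt J 𝓘(ℝ, E →L[ℝ] E →L[ℝ] ℝ) ∞ B s x₀)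
    (hA : ContMDiffWithinAt J 𝓘(ℝ, E →L[ℝ] E) ∞ A s x₀) :
    ContMDiffWithinAt J 𝓘(ℝ, E →L[ℝ] E →L[ℝ] ℝ) ∞
      (fun x => (B x).bilinearComp (A x) (A x)) s x₀ := by
  have hflip : ContMDiff 𝓘(ℝ, E →L[ℝ] E →L[ℝ] ℝ) 𝓘(ℝ, E →L[ℝ] E →L[ℝ] ℝ) ∞
      (fun B : E →L[ℝ] E →L[ℝ] ℝ => B.flip) :=
    contDiff_flip.contMDiff
  exact hflip.contMDiffAt.comp_contMDiffWithinAt x₀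
    ((hflip.contMDiffAt.comp_contMDiffWithinAt x₀ (hB.clm_comp hA)).clm_comp hA)

namespace SmoothForm

variable {Ω : M → E →L[ℝ] E →L[ℝ] ℝ}

theorem neg (hω : SmoothForm Ω) : SmoothForm (fun p => -Ω p) := by
  intro p₀
  have : ContMDiff 𝓘(ℝ, E →L[ℝ] E →L[ℝ] ℝ) 𝓘(ℝ, E →L[ℝ] E →L[ℝ] ℝ) ∞
      (fun B : E →L[ℝ] E →L[ℝ] ℝ => -B) := contDiff_neg.contMDiff
  exact this.contMDiffAt.comp p₀ (hω p₀)

/-- Inserting a smooth family of vectors into a smooth form gives a smooth family of covectors. -/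
theorem apply (hω : SmoothForm Ω) {g : N → M} {u : N → E} (hu : SmoothVec J g u s x₀) :
    SmoothCov J g (fun x => Ω (g x) (u x)) s x₀ := by
  refine ⟨hu.base, ContMDiffWithinAt.congr_eventually
    (((hω (g x₀)).comp_contMDiffWithinAt x₀ hu.base).clm_apply hu.coord) ?_ ?_⟩
  · filter_upwards [eventually_mem_chart_source hu.base] with x hx
    ext v
    simp [fromChart_toChart hx]
  · ext v
    simp [fromChart_toChart (mem_chart_source E _)]

/-- The pullback of a smooth form by a smooth map `h`, along a smooth family of linear maps of the
tangent spaces. -/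
theorem pullback {Ω : M' → E →L[ℝ] E →L[ℝ] ℝ} (hω : SmoothForm Ω) {h : M → M'}
    {L : M → E →L[ℝ] E} (hL : ∀ p, SmoothHom 𝓘(ℝ, E) (fun p => p) h L univ p) :
    SmoothForm (fun p => (Ω (h p)).bilinearComp (L p) (L p)) := by
  intro p₀
  have h1 := ContMDiffWithinAt.clm_bilinearComp
    ((hω (h p₀)).comp_contMDiffWithinAt p₀ (hL p₀).base') (hL p₀).coord
  rw [← contMDiffWithinAt_univ]
  refine h1.congr_eventually ?_ ?_
  · filter_upwards [eventually_mem_chart_source (hL p₀).base'] with x hx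
    ext v w
    simp [fromChart_toChart hx]
  · ext v w
    simp [fromChart_toChart (mem_chart_source E _)]

end SmoothForm

/-- The expression of the 1-form `β` in the chart around `p₀`. -/
def localForm (β : M → E →L[ℝ] ℝ) (p₀ : M) (y : E) : E →L[ℝ] ℝ :=
  (β ((extChartAt 𝓘(ℝ, E) p₀).symm y)).comp (tmap E (extChartAt 𝓘(ℝ, E) p₀).symm y)

/-- The exterior derivative of the 1-form `β` at `p`, computed in the chart around `p`. -/
def extDer (β : M → E →L[ℝ] ℝ) (p : M) : E →L[ℝ] E →L[ℝ] ℝ :=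
  (fderiv ℝ (localForm β p) (extChartAt 𝓘(ℝ, E) p p) -
    (fderiv ℝ (localForm β p) (extChartAt 𝓘(ℝ, E) p p)).flip).bilinearComp
      (tmap E (extChartAt 𝓘(ℝ, E) p) p) (tmap E (extChartAt 𝓘(ℝ, E) p) p)

theorem mdifferentiableAt_chart {p₀ p : M} (h : p ∈ (chartAt E p₀).source) :
    MDifferentiableAt 𝓘(ℝ, E) 𝓘(ℝ, E) (extChartAt 𝓘(ℝ, E) p₀) p :=
  mdifferentiableAt_extChartAt h

theorem contMDiffAt_chart_symm {p₀ : M} {y : E} (h : y ∈ (extChartAt 𝓘(ℝ, E) p₀).target) :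
    ContMDiffAt 𝓘(ℝ, E) 𝓘(ℝ, E) ∞ (extChartAt 𝓘(ℝ, E) p₀).symm y :=
  (contMDiffOn_extChartAt_symm p₀).contMDiffAt ((isOpen_extChartAt_target p₀).mem_nhds h)

theorem mdifferentiableAt_chart_symm {p₀ : M} {y : E} (h : y ∈ (extChartAt 𝓘(ℝ, E) p₀).target) :
    MDifferentiableAt 𝓘(ℝ, E) 𝓘(ℝ, E) (extChartAt 𝓘(ℝ, E) p₀).symm y :=
  (contMDiffAt_chart_symm h).mdifferentiableAt (by simp)

set_option synthInstance.maxHeartbeats 200000 in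
/-- The exterior derivative may be computed in any chart: the second derivative of the change of
charts is symmetric. -/
theorem extDer_eq {β : M → E →L[ℝ] ℝ} {p₀ p : M} (hp : p ∈ (chartAt E p₀).source)
    (hb : DifferentiableAt ℝ (localForm β p₀) (extChartAt 𝓘(ℝ, E) p₀ p)) :
    extDer β p = (fderiv ℝ (localForm β p₀) (extChartAt 𝓘(ℝ, E) p₀ p) -
      (fderiv ℝ (localForm β p₀) (extChartAt 𝓘(ℝ, E) p₀ p)).flip).bilinearComp
        (toChart E p₀ p) (toChart E p₀ p) := by
  set e := extChartAt 𝓘(ℝ, E) p with he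
  set e₀ := extChartAt 𝓘(ℝ, E) p₀ with he₀
  have hpe : p ∈ e.source := mem_extChartAt_source p
  have hpe₀ : p ∈ e₀.source := by rwa [he₀, extChartAt_source]
  set g : E → E := fun y => e₀ (e.symm y) with hg
  have hgy : g (e p) = e₀ p := by simp [hg, e.left_inv hpe]
  -- near `e p` the point `e.symm y` lies in both chart domains
  have hnear : ∀ᶠ y in nhds (e p), y ∈ e.target ∧ e.symm y ∈ e₀.source := by
    refine Filter.Eventually.and ((isOpen_extChartAt_target p).mem_nhds (e.map_source hpe)) ?_
    refine (continuousAt_extChartAt_symm (I := 𝓘(ℝ, E)) p).eventually ?_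
    rw [← he, e.left_inv hpe]
    exact (isOpen_extChartAt_source (I := 𝓘(ℝ, E)) p₀).mem_nhds hpe₀
  have hgs : ∀ y, y ∈ e.target → e.symm y ∈ e₀.source → ContDiffAt ℝ ∞ g y := by
    intro y hy hy'
    rw [← contMDiffAt_iff_contDiffAt]
    refine ContMDiffAt.comp y ?_ (contMDiffAt_chart_symm hy)
    exact contMDiffAt_extChartAt' (by simpa [he₀] using hy')
  have hgd : ContDiffAt ℝ ∞ g (e p) :=
    hgs _ hnear.self_of_nhds.1 hnear.self_of_nhds.2
  have hloc : localForm β p =ᶠ[nhds (e p)]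
      fun y => (localForm β p₀ (g y)).comp (fderiv ℝ g y) := by
    filter_upwards [hnear.eventually_nhds] with y hy
    have hy0 := hy.self_of_nhds
    have hsymm : (fun z => e₀.symm (g z)) =ᶠ[nhds y] e.symm := by
      filter_upwards [hy] with z hz
      exact e₀.left_inv hz.2
    unfold localForm
    rw [← he, ← he₀, ← hsymm.self_of_nhds, ← tmap_congr hsymm,
      tmap_comp (g := e₀.symm) (f := g) (mdifferentiableAt_chart_symm (e₀.map_source hy0.2))
      ((hgs y hy0.1 hy0.2).differentiableAt (by simp)).mdifferentiableAt,
      tmap_eq_fderiv]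
    rfl
  have hb' : HasFDerivAt (localForm β p₀) (fderiv ℝ (localForm β p₀) (e₀ p)) (g (e p)) := by
    rw [hgy]; exact hb.hasFDerivAt
  have hg1 : HasFDerivAt g (fderiv ℝ g (e p)) (e p) :=
    (hgd.differentiableAt (by simp)).hasFDerivAt
  have hg2 : HasFDerivAt (fderiv ℝ g) (fderiv ℝ (fderiv ℝ g) (e p)) (e p) :=
    ((hgd.fderiv_right (m := ∞) le_rfl).differentiableAt
      (by simp)).hasFDerivAt
  have hsym : IsSymmSndFDerivAt ℝ g (e p) :=
    hgd.isSymmSndFDerivAt (by simpa using ENat.LEInfty.out)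
  have hder := ((hb'.comp (e p) hg1).clm_comp hg2).congr_of_eventuallyEq hloc
  have hA : ∀ v, fderiv ℝ g (e p) (tmap E e p v) = toChart E p₀ p v := by
    intro v
    have h1 : (fun q => g (e q)) =ᶠ[nhds p] e₀ := by
      filter_upwards [(isOpen_extChartAt_source (I := 𝓘(ℝ, E)) p).mem_nhds hpe] with q hq
      simp only [hg, he]
      rw [(extChartAt 𝓘(ℝ, E) p).left_inv hq]
    rw [toChart_eq_tmap hp, ← he₀, ← tmap_congr h1, tmap_comp hg1.differentiableAt.mdifferentiableAt
      (mdifferentiableAt_chart (mem_chart_source E p)), tmap_eq_fderiv]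
    rfl
  ext u v
  rw [extDer, ← he, hder.fderiv]
  have := hsym.eq (tmap E e p u) (tmap E e p v)
  simp [hA, hgy, this]

/-- The exterior derivative of a smooth 1-form is smooth. -/
theorem smoothForm_extDer {β : M → E →L[ℝ] ℝ}
    (hβ : ∀ p₀, ContDiffOn ℝ ∞ (localForm β p₀) (extChartAt 𝓘(ℝ, E) p₀).target) :
    SmoothForm (extDer β) := by
  intro p₀
  have hopen := isOpen_extChartAt_target (I := 𝓘(ℝ, E)) p₀
  have h1 : ContDiffOn ℝ ∞ (fderiv ℝ (localForm β p₀)) (extChartAt 𝓘(ℝ, E) p₀).target :=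
    (hβ p₀).fderiv_of_isOpen hopen le_rfl
  have h2 : ContDiffAt ℝ ∞ (fun y => fderiv ℝ (localForm β p₀) y -
      (fderiv ℝ (localForm β p₀) y).flip) (extChartAt 𝓘(ℝ, E) p₀ p₀) := by
    have h3 := h1.contDiffAt (hopen.mem_nhds (mem_extChartAt_target p₀))
    exact h3.sub (contDiff_flip.contDiffAt.comp _ h3)
  refine (h2.contMDiffAt.comp p₀ contMDiffAt_extChartAt).congr_of_eventuallyEq ?_
  filter_upwards [(chartAt E p₀).open_source.mem_nhds (mem_chart_source E p₀)] with p hp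
  have hd : DifferentiableAt ℝ (localForm β p₀) (extChartAt 𝓘(ℝ, E) p₀ p) :=
    ((hβ p₀).differentiableOn (by simp)).differentiableAt
      (hopen.mem_nhds ((extChartAt 𝓘(ℝ, E) p₀).map_source (by rwa [extChartAt_source])))
  rw [extDer_eq hp hd]
  ext u v
  simp [toChart_fromChart hp]

end Forms

/-! ### Smooth dependence of integrals on parameters -/

section Integral

open MeasureTheory

universe u

/-- Differentiation under the integral sign over `[0, 1]`. -/
theorem hasFDerivAt_integral_of_contDiffOn {E G : Type u} [NormedAddCommGroup E] [NormedSpace ℝ E]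
    [ProperSpace E] [NormedAddCommGroup G] [NormedSpace ℝ G] [CompleteSpace G]
    {F : ℝ × E → G} {U : Set E} (hU : IsOpen U)
    (hF : ContDiffOn ℝ 1 F (Icc 0 1 ×ˢ U)) {y : E} (hy : y ∈ U) :
    HasFDerivAt (fun y => ∫ s in (0 : ℝ)..1, F (s, y))
      (∫ s in (0 : ℝ)..1, (fderivWithin ℝ F (Icc 0 1 ×ˢ U) (s, y)).comp
        (ContinuousLinearMap.inr ℝ ℝ E)) y := by
  have hS : UniqueDiffOn ℝ (Icc (0 : ℝ) 1 ×ˢ U) := (uniqueDiffOn_Icc zero_lt_one).prod hU.uniqueDiffOn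
  obtain ⟨r, hr, hrU⟩ := Metric.nhds_basis_closedBall.mem_iff.1 (hU.mem_nhds hy)
  set F' : ℝ × E → E →L[ℝ] G := fun z =>
    (fderivWithin ℝ F (Icc 0 1 ×ˢ U) z).comp (ContinuousLinearMap.inr ℝ ℝ E) with hF'
  have hF'c : ContinuousOn F' (Icc 0 1 ×ˢ U) :=
    (hF.continuousOn_fderivWithin hS le_rfl).clm_comp continuousOn_const
  have hK : IsCompact (Icc (0 : ℝ) 1 ×ˢ Metric.closedBall y r) :=
    isCompact_Icc.prod (isCompact_closedBall y r)
  obtain ⟨C, hC⟩ := hK.exists_bound_of_continuousOn (hF'c.mono (prod_mono_right hrU))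
  have hslice : ∀ x ∈ U, MapsTo (fun s : ℝ => (s, x)) (Icc 0 1) (Icc 0 1 ×ˢ U) :=
    fun x hx s hs => ⟨hs, hx⟩
  have hm : ∀ {H : Type u} [NormedAddCommGroup H] {f : ℝ × E → H},
      ContinuousOn f (Icc 0 1 ×ˢ U) → ∀ x ∈ U, AEStronglyMeasurable (fun s => f (s, x))
        (volume.restrict (uIoc (0 : ℝ) 1)) := by
    intro H _ f hf x hx
    rw [uIoc_of_le zero_le_one]
    exact ((hf.comp (by fun_prop) (hslice x hx)).mono Ioc_subset_Icc_self).aestronglyMeasurable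
      measurableSet_Ioc
  refine intervalIntegral.hasFDerivAt_integral_of_dominated_of_fderiv_le
    (F := fun y s => F (s, y)) (F' := fun y s => F' (s, y)) (bound := fun _ => C)
    (Metric.ball_mem_nhds y hr) ?_ ?_ (hm hF'c y hy) ?_ ?_ ?_
  · filter_upwards [hU.mem_nhds hy] with x hx using hm hF.continuousOn x hx
  · refine ContinuousOn.intervalIntegrable ?_
    rw [uIcc_of_le zero_le_one]
    exact hF.continuousOn.comp (by fun_prop) (hslice y hy)
  · refine .of_forall fun s hs x hx => hC _ ⟨?_, Metric.ball_subset_closedBall hx⟩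
    rw [uIoc_of_le zero_le_one] at hs
    exact Ioc_subset_Icc_self hs
  · exact intervalIntegrable_const
  · refine .of_forall fun s hs x hx => ?_
    rw [uIoc_of_le zero_le_one] at hs
    have hx' : x ∈ U := hrU (Metric.ball_subset_closedBall hx)
    have h1 := ((hF.differentiableOn one_ne_zero) (s, x)
      ⟨Ioc_subset_Icc_self hs, hx'⟩).hasFDerivWithinAt
    have h2 := h1.comp x (hasFDerivAt_prodMk_right s x).hasFDerivWithinAt
      (show MapsTo (fun z => (s, z)) U (Icc (0 : ℝ) 1 ×ˢ U) from
        fun z hz => ⟨Ioc_subset_Icc_self hs, hz⟩)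
    exact h2.hasFDerivAt (hU.mem_nhds hx')

theorem contDiffOn_integral_nat {E : Type u} [NormedAddCommGroup E] [NormedSpace ℝ E]
    [ProperSpace E] {U : Set E} (hU : IsOpen U) (n : ℕ) : ∀ {G : Type u} [NormedAddCommGroup G]
    [NormedSpace ℝ G] [CompleteSpace G] {F : ℝ × E → G}, ContDiffOn ℝ ∞ F (Icc 0 1 ×ˢ U) →
    ContDiffOn ℝ n (fun y => ∫ s in (0 : ℝ)..1, F (s, y)) U := by
  have hS : UniqueDiffOn ℝ (Icc (0 : ℝ) 1 ×ˢ U) := (uniqueDiffOn_Icc zero_lt_one).prod hU.uniqueDiffOn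
  induction n with
  | zero =>
    intro G _ _ _ F hF
    refine contDiffOn_zero.2 fun y hy => ContinuousAt.continuousWithinAt ?_
    exact (hasFDerivAt_integral_of_contDiffOn hU (hF.of_le (by simp)) hy).continuousAt
  | succ n ih =>
    intro G _ _ _ F hF
    have hd : ∀ y ∈ U, _ := fun y hy =>
      hasFDerivAt_integral_of_contDiffOn hU (hF.of_le (by simp)) hy
    rw [Nat.cast_add, Nat.cast_one, contDiffOn_succ_iff_fderiv_of_isOpen hU]
    refine ⟨fun y hy => (hd y hy).differentiableAt.differentiableWithinAt, by simp, ?_⟩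
    refine ContDiffOn.congr ?_ fun y hy => (hd y hy).fderiv
    exact ih ((hF.fderivWithin hS le_rfl).clm_comp contDiffOn_const)

/-- The integral over `[0, 1]` of a smooth function of time and a parameter is smooth. -/
theorem contDiffOn_integral {E G : Type u} [NormedAddCommGroup E] [NormedSpace ℝ E]
    [ProperSpace E] [NormedAddCommGroup G] [NormedSpace ℝ G] [CompleteSpace G]
    {F : ℝ × E → G} {U : Set E} (hU : IsOpen U) (hF : ContDiffOn ℝ ∞ F (Icc 0 1 ×ˢ U)) :
    ContDiffOn ℝ ∞ (fun y => ∫ s in (0 : ℝ)..1, F (s, y)) U :=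
  contDiffOn_infty.2 fun n => contDiffOn_integral_nat hU n hF

end Integral

/-! ### Velocities of paths -/

section Velocity

variable {E : Type*} [NormedAddCommGroup E] [NormedSpace ℝ E]
  {M : Type*} [TopologicalSpace M] [ChartedSpace E M] [IsManifold 𝓘(ℝ, E) ∞ M]
  {EN : Type*} [NormedAddCommGroup EN] [NormedSpace ℝ EN] {HN : Type*} [TopologicalSpace HN]
  {J : ModelWithCorners ℝ EN HN} {N : Type*} [TopologicalSpace N] [ChartedSpace HN N]
  [IsManifold J 1 N] {s : Set N} {x₀ : N}

/-- The velocities of a smooth family of paths form a smooth family of tangent vectors. -/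
theorem smoothVec_velocity {G : N → ℝ → M} {τ : N → ℝ}
    (hG : ContMDiffWithinAt (J.prod 𝓘(ℝ, ℝ)) 𝓘(ℝ, E) ∞ (fun z : N × ℝ => G z.1 z.2)
      (s ×ˢ Icc 0 1) (x₀, τ x₀))
    (hτ : ContMDiffWithinAt J 𝓘(ℝ, ℝ) ∞ τ s x₀) (hx₀ : x₀ ∈ s) (hmaps : MapsTo τ s (Icc 0 1)) :
    SmoothVec J (fun x => G x (τ x))
      (fun x => (mfderivWithin 𝓘(ℝ, ℝ) 𝓘(ℝ, E) (G x) (Icc 0 1) (τ x) : ℝ →L[ℝ] E) 1) s x₀ := by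
  refine ⟨?_, ?_⟩
  · exact hG.comp (f := fun x => (x, τ x)) x₀ (contMDiffWithinAt_id.prodMk hτ)
      (fun x hx => ⟨hx, hmaps hx⟩)
  · have h := ContMDiffWithinAt.mfderivWithin (f := G) (m := ∞) hG hτ hx₀ hmaps le_rfl
      (uniqueDiffOn_Icc zero_lt_one).uniqueMDiffOn
    refine (h.clm_apply (contMDiffWithinAt_const (c := (1 : ℝ)))).congr_eventually ?_ ?_
    · refine .of_forall fun x => ?_
      simp only [inTangentCoordinates, ContinuousLinearMap.inCoordinates]
      erw [TangentBundle.symmL_model_space]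
      rfl
    · simp only [inTangentCoordinates, ContinuousLinearMap.inCoordinates]
      erw [TangentBundle.symmL_model_space]
      rfl

variable {D : ℕ} {M : Type*} [TopologicalSpace M] [ChartedSpace (DoubledSpace D) M]

theorem velocity_comp {f : M → M} {γ : unitInterval → M} {t : unitInterval}
    (hf : MDifferentiableAt 𝓘(ℝ, DoubledSpace D) 𝓘(ℝ, DoubledSpace D) f (γ t))
    (hγ : MDifferentiableWithinAt 𝓘(ℝ, ℝ) 𝓘(ℝ, DoubledSpace D) (IccExtend zero_le_one γ)
      (Icc 0 1) (t : ℝ)) :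
    velocity (D := D) (fun t => f (γ t)) t =
      tmap (DoubledSpace D) f (γ t) (velocity (D := D) γ t) := by
  have h := mfderiv_comp_mfderivWithin_of_eq (I := 𝓘(ℝ, ℝ)) (I' := 𝓘(ℝ, DoubledSpace D))
    (I'' := 𝓘(ℝ, DoubledSpace D)) (f := IccExtend zero_le_one γ) (g := f) (s := Icc 0 1)
    (x := (t : ℝ)) (y := γ t) hf hγ
    ((uniqueDiffOn_Icc zero_lt_one).uniqueMDiffOn _ t.2) (by simp)
  have h' : IccExtend zero_le_one (fun t => f (γ t)) = f ∘ IccExtend zero_le_one γ := rfl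
  unfold velocity
  rw [h', h]
  rfl

end Velocity

section ParaHermitian

variable {D : ℕ} {M : Type*} [TopologicalSpace M] [ChartedSpace (DoubledSpace D) M]
  [IsManifold 𝓘(ℝ, DoubledSpace D) ∞ M]

/-! ### Smoothness of the para-complex structure -/

namespace ParaHermitian

variable (S : ParaHermitian D M)

/-- The para-complex structure at `p`, acting on the model space. -/
def Kmap (p : M) : DoubledSpace D →L[ℝ] DoubledSpace D := S.K p

theorem Kmap_Kmap (p : M) (v : DoubledSpace D) : S.Kmap p (S.Kmap p v) = v := S.K_sq p v

/-- The field `K` is smooth, since it is constant in foliated charts. -/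
theorem smoothHom_Kmap (p₀ : M) :
    SmoothHom 𝓘(ℝ, DoubledSpace D) (fun p : M => p) (fun p => p) S.Kmap univ p₀ := by
  obtain ⟨e, he, hp₀, hK⟩ := S.doubled_foliations p₀
  set P := stdParaComplex D
  have hes : ∀ q ∈ e.source, ContMDiffAt 𝓘(ℝ, DoubledSpace D) 𝓘(ℝ, DoubledSpace D) ∞ e q :=
    fun q hq => contMDiffAt_of_mem_maximalAtlas he hq
  have hesymm : ∀ y ∈ e.target,
      ContMDiffAt 𝓘(ℝ, DoubledSpace D) 𝓘(ℝ, DoubledSpace D) ∞ e.symm y :=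
    fun y hy => contMDiffAt_symm_of_mem_maximalAtlas he hy
  -- `G p` is the map with derivative `K` at `p` which is linear in the foliated chart
  set G : M → M → M := fun p x => e.symm (P (e x - e p) + e p) with hG
  have hGs : ContMDiffAt (𝓘(ℝ, DoubledSpace D).prod 𝓘(ℝ, DoubledSpace D)) 𝓘(ℝ, DoubledSpace D) ∞
      (fun z : M × M => G z.1 z.2) (p₀, p₀) := by
    refine ContMDiffAt.comp (I' := 𝓘(ℝ, DoubledSpace D)) (g := e.symm)
      (f := fun z : M × M => P (e z.2 - e z.1) + e z.1) (p₀, p₀) ?_ ?_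
    · refine hesymm _ ?_
      simpa using e.map_source hp₀
    · have h1 := (hes p₀ hp₀).comp (p₀, p₀) (contMDiffAt_fst (I := 𝓘(ℝ, DoubledSpace D))
        (J := 𝓘(ℝ, DoubledSpace D)) (M := M) (N := M) (n := ∞) (p := (p₀, p₀)))
      have h2 := (hes p₀ hp₀).comp (p₀, p₀) (contMDiffAt_snd (I := 𝓘(ℝ, DoubledSpace D))
        (J := 𝓘(ℝ, DoubledSpace D)) (M := M) (N := M) (n := ∞) (p := (p₀, p₀)))
      have hP : ContMDiff 𝓘(ℝ, DoubledSpace D) 𝓘(ℝ, DoubledSpace D) ∞ P := P.contDiff.contMDiff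
      exact (hP.contMDiffAt.comp (p₀, p₀) (h2.sub h1)).add h1
  have h := SmoothHom.tmap (J := 𝓘(ℝ, DoubledSpace D)) (s := univ) (G := G) (g := fun p => p)
    (x₀ := p₀) (by simpa using hGs.contMDiffWithinAt) contMDiffWithinAt_id (mem_univ _)
  have key : ∀ q ∈ e.source, q = q ∧ q = G q q ∧ S.Kmap q = tmap (DoubledSpace D) (G q) q := by
    intro q hq
    have hmd := (hes q hq).mdifferentiableAt (by simp)
    have hGq : G q q = q := by simp [hG, e.left_inv hq]
    refine ⟨rfl, hGq.symm, ?_⟩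
    have hq' : P (e q - e q) + e q = e q := by simp
    have haff : HasFDerivAt (fun y => P (y - e q) + e q) P (e q) :=
      (P.hasFDerivAt.comp (e q) ((hasFDerivAt_id _).sub_const (e q))).add_const (e q)
    have hsymmd : MDifferentiableAt 𝓘(ℝ, DoubledSpace D) 𝓘(ℝ, DoubledSpace D) e.symm
        (P (e q - e q) + e q) := by
      rw [hq']; exact (hesymm _ (e.map_source hq)).mdifferentiableAt (by simp)
    have h1 : tmap (DoubledSpace D) (G q) q = (tmap (DoubledSpace D) e.symm (e q)).comp
        (P.comp (tmap (DoubledSpace D) e q)) := by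
      rw [tmap_comp (g := e.symm) (f := fun x => P (e x - e q) + e q) hsymmd
        (haff.differentiableAt.mdifferentiableAt.comp q hmd), hq',
        tmap_comp (g := fun y => P (y - e q) + e q) (f := e)
          haff.differentiableAt.mdifferentiableAt hmd, tmap_eq_fderiv, haff.fderiv]
    have h2 : (tmap (DoubledSpace D) e.symm (e q)).comp (tmap (DoubledSpace D) e q) =
        ContinuousLinearMap.id ℝ _ := by
      rw [hq'] at hsymmd
      rw [← tmap_comp hsymmd hmd, ← tmap_id q]
      refine tmap_congr ?_
      filter_upwards [e.open_source.mem_nhds hq] with x hx using e.left_inv hx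
    rw [h1]
    refine ContinuousLinearMap.ext fun v => ?_
    have h3 : P (tmap (DoubledSpace D) e q v) = tmap (DoubledSpace D) e q (S.Kmap q v) :=
      (hK q hq v).symm
    have h4 := DFunLike.congr_fun h2 (S.Kmap q v)
    simp only [ContinuousLinearMap.comp_apply, ContinuousLinearMap.id_apply] at h4 ⊢
    rw [h3, h4]
  refine h.congr ?_ (key p₀ hp₀)
  filter_upwards [mem_nhdsWithin_of_mem_nhds (e.open_source.mem_nhds hp₀)] with q hq using key q hq

/-- The projection onto the eigenbundle of `K` with eigenvalue `ε`, acting on the model space. -/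
def projMap (ε : ℝ) (p : M) : DoubledSpace D →L[ℝ] DoubledSpace D :=
  (2⁻¹ : ℝ) • (ContinuousLinearMap.id ℝ _ + ε • S.Kmap p)

theorem smoothHom_projMap (ε : ℝ) (p₀ : M) :
    SmoothHom 𝓘(ℝ, DoubledSpace D) (fun p : M => p) (fun p => p) (S.projMap ε) univ p₀ :=
  ((SmoothHom.id (S.smoothHom_Kmap p₀).base).add ((S.smoothHom_Kmap p₀).const_smul ε)).const_smul _

theorem projMap_Kmap {ε : ℝ} (hε : ε * ε = 1) (p : M) (v : DoubledSpace D) :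
    S.projMap ε p (S.Kmap p v) = ε • S.projMap ε p v := by
  simp only [projMap, smul_apply, add_apply,
    ContinuousLinearMap.id_apply, Kmap_Kmap, smul_smul, smul_add]
  rw [add_comm, mul_left_comm, hε, mul_one, mul_comm]

end ParaHermitian

end ParaHermitian

section Bisections

variable {D : ℕ} {M : Type*} [TopologicalSpace M] [ChartedSpace (DoubledSpace D) M]
  [IsManifold 𝓘(ℝ, DoubledSpace D) ∞ M]

/-! ### The forms of a bisection -/

namespace LeafBisection

variable {S : ParaHermitian D M} {ε : ℝ} (σ : LeafBisection S ε)

theorem contMDiffOn_base : ContMDiffOn (𝓘(ℝ, ℝ).prod 𝓘(ℝ, DoubledSpace D)) 𝓘(ℝ, DoubledSpace D) ∞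
    (fun q : ℝ × M => (IccExtend zero_le_one σ.η q.1 q.2).proj) (Icc 0 1 ×ˢ univ) :=
  fun q hq => (contMDiffWithinAt_cotangent.1 (σ.smooth q hq)).base

theorem contMDiff_φ (t : unitInterval) :
    ContMDiff 𝓘(ℝ, DoubledSpace D) 𝓘(ℝ, DoubledSpace D) ∞ (σ.φ t) := by
  rw [← contMDiffOn_univ]
  have h := σ.contMDiffOn_base.comp (f := fun p : M => ((t : ℝ), p))
    (contMDiff_const.prodMk contMDiff_id).contMDiffOn (s := univ) (fun p _ => ⟨t.2, mem_univ _⟩)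
  refine h.congr fun p _ => ?_
  simp [φ]

theorem mdifferentiableAt_φ (t : unitInterval) (p : M) :
    MDifferentiableAt 𝓘(ℝ, DoubledSpace D) 𝓘(ℝ, DoubledSpace D) (σ.φ t) p :=
  (σ.contMDiff_φ t).mdifferentiable (by simp) p

/-- The derivatives of the base maps of a bisection commute with `K`. -/
theorem tmap_Kmap (t : unitInterval) (p : M) (v : DoubledSpace D) :
    tmap (DoubledSpace D) (σ.φ t) p (S.Kmap p v) =
      S.Kmap (σ.φ t p) (tmap (DoubledSpace D) (σ.φ t) p v) :=
  σ.foliated t p v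

/-- The integrand of the 1-form `β`, in the chart around `p₀`. -/
def localIntegrand (p₀ : M) (z : ℝ × DoubledSpace D) : DoubledSpace D →L[ℝ] ℝ :=
  ContinuousLinearMap.comp
    (show DoubledSpace D →L[ℝ] ℝ from
      (IccExtend zero_le_one σ.η z.1 ((extChartAt 𝓘(ℝ, DoubledSpace D) p₀).symm z.2)).snd)
    (tmap (DoubledSpace D) (fun y : DoubledSpace D => (IccExtend zero_le_one σ.η z.1
      ((extChartAt 𝓘(ℝ, DoubledSpace D) p₀).symm y)).proj) z.2)

theorem contDiffOn_localIntegrand (p₀ : M) : ContDiffOn ℝ ∞ (σ.localIntegrand p₀)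
    (Icc 0 1 ×ˢ (extChartAt 𝓘(ℝ, DoubledSpace D) p₀).target) := by
  intro z₀ hz₀
  set e := extChartAt 𝓘(ℝ, DoubledSpace D) p₀ with he
  set A := Icc (0 : ℝ) 1 ×ˢ e.target with hA
  have hopen : IsOpen e.target := isOpen_extChartAt_target p₀
  have hsymm : ContMDiffOn 𝓘(ℝ, DoubledSpace D) 𝓘(ℝ, DoubledSpace D) ∞ e.symm e.target :=
    contMDiffOn_extChartAt_symm p₀
  have hfst : ContMDiff 𝓘(ℝ, ℝ × DoubledSpace D) 𝓘(ℝ, ℝ) ∞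
      (fun z : ℝ × DoubledSpace D => z.1) := contDiff_fst.contMDiff
  have hsnd : ContMDiff 𝓘(ℝ, ℝ × DoubledSpace D) 𝓘(ℝ, DoubledSpace D) ∞
      (fun z : ℝ × DoubledSpace D => z.2) := contDiff_snd.contMDiff
  have hmap : ContMDiffWithinAt 𝓘(ℝ, ℝ × DoubledSpace D) (𝓘(ℝ, ℝ).prod 𝓘(ℝ, DoubledSpace D)) ∞
      (fun z : ℝ × DoubledSpace D => (z.1, e.symm z.2)) A z₀ :=
    (hfst.contMDiffAt.contMDiffWithinAt).prodMk
      ((hsymm z₀.2 hz₀.2).comp z₀ hsnd.contMDiffAt.contMDiffWithinAt fun z hz => hz.2)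
  have hcov := contMDiffWithinAt_cotangent.1 (ContMDiffWithinAt.comp z₀
    (σ.smooth (z₀.1, e.symm z₀.2) ⟨hz₀.1, mem_univ _⟩) hmap
    (show MapsTo _ A (Icc (0 : ℝ) 1 ×ˢ univ) from fun z hz => ⟨hz.1, mem_univ _⟩))
  have hG : ContMDiffWithinAt (𝓘(ℝ, ℝ × DoubledSpace D).prod 𝓘(ℝ, DoubledSpace D))
      𝓘(ℝ, DoubledSpace D) ∞ (fun w : (ℝ × DoubledSpace D) × DoubledSpace D =>
        (IccExtend zero_le_one σ.η w.1.1 (e.symm w.2)).proj) (A ×ˢ univ) (z₀, z₀.2) := by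
    have h1 : ContMDiffWithinAt (𝓘(ℝ, ℝ × DoubledSpace D).prod 𝓘(ℝ, DoubledSpace D))
        (𝓘(ℝ, ℝ).prod 𝓘(ℝ, DoubledSpace D)) ∞
        (fun w : (ℝ × DoubledSpace D) × DoubledSpace D => (w.1.1, e.symm w.2))
        (A ×ˢ univ) (z₀, z₀.2) := by
      refine ContMDiffWithinAt.prodMk (hfst.comp contMDiff_fst).contMDiffAt.contMDiffWithinAt ?_
      exact ((hsymm.contMDiffAt (hopen.mem_nhds hz₀.2)).comp (z₀, z₀.2)
        contMDiffAt_snd).contMDiffWithinAt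
    exact ContMDiffWithinAt.comp (z₀, z₀.2)
      (f := fun w : (ℝ × DoubledSpace D) × DoubledSpace D => (w.1.1, e.symm w.2))
      (σ.contMDiffOn_base (z₀.1, e.symm z₀.2) ⟨hz₀.1, mem_univ _⟩) h1
      (show MapsTo _ (A ×ˢ univ) (Icc (0 : ℝ) 1 ×ˢ univ) from fun w hw => ⟨hw.1.1, mem_univ _⟩)
  have hhom := SmoothHom.tmap (J := 𝓘(ℝ, ℝ × DoubledSpace D))
    (G := fun z y => (IccExtend zero_le_one σ.η z.1 (e.symm y)).proj) (g := fun z => z.2) hG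
    hsnd.contMDiffAt.contMDiffWithinAt hz₀
  have h := (SmoothCov.comp hcov hhom).coord
  simp only [fromChart_model, ContinuousLinearMap.comp_id] at h
  exact contMDiffWithinAt_iff_contDiffWithinAt.1 h

/-- The 1-form `β` is smooth. -/
theorem contDiffOn_localForm_β (p₀ : M) : ContDiffOn ℝ ∞
    (localForm (E := DoubledSpace D) σ.β p₀) (extChartAt 𝓘(ℝ, DoubledSpace D) p₀).target := by
  set e := extChartAt 𝓘(ℝ, DoubledSpace D) p₀ with he
  refine (contDiffOn_integral (isOpen_extChartAt_target p₀)
    (σ.contDiffOn_localIntegrand p₀)).congr fun y hy => ?_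
  set f : ℝ → DoubledSpace D →L[ℝ] ℝ := IccExtend zero_le_one (fun s : unitInterval =>
    (((σ.η s (e.symm y)).snd.comp (mfderiv 𝓘(ℝ, DoubledSpace D) 𝓘(ℝ, DoubledSpace D) (σ.φ s)
      (e.symm y)) : DoubledSpace D →L[ℝ] ℝ))) with hf
  have hsd : MDifferentiableAt 𝓘(ℝ, DoubledSpace D) 𝓘(ℝ, DoubledSpace D) e.symm y :=
    mdifferentiableAt_chart_symm hy
  have hfs : ∀ s, (f s).comp (tmap (DoubledSpace D) e.symm y) = σ.localIntegrand p₀ (s, y) := by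
    intro s
    have h1 := tmap_comp (g := σ.φ (projIcc 0 1 zero_le_one s)) (f := e.symm) (p := y)
      (σ.mdifferentiableAt_φ _ _) hsd
    unfold localIntegrand
    exact congrArg (ContinuousLinearMap.comp _) h1.symm
  -- the derivative of the chart is invertible, so `f` inherits continuity from the integrand
  have hinv : (tmap (DoubledSpace D) e.symm y).comp (tmap (DoubledSpace D) e (e.symm y)) =
      ContinuousLinearMap.id ℝ _ := by
    have hsrc : e.symm y ∈ (chartAt (DoubledSpace D) p₀).source := by
      rw [← extChartAt_source 𝓘(ℝ, DoubledSpace D)]; exact e.map_target hy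
    refine ContinuousLinearMap.ext fun v => ?_
    have h2 := fromChart_toChart hsrc v
    rw [toChart_eq_tmap hsrc, fromChart_eq_tmap hsrc, ← he, e.right_inv hy] at h2
    exact h2
  have hfc : IntervalIntegrable f MeasureTheory.volume 0 1 := by
    have h3 : f = fun s => (σ.localIntegrand p₀ (s, y)).comp
        (tmap (DoubledSpace D) e (e.symm y)) := by
      funext s
      rw [← hfs, ContinuousLinearMap.comp_assoc, hinv, ContinuousLinearMap.comp_id]
    rw [h3]
    refine ContinuousOn.intervalIntegrable ?_
    rw [uIcc_of_le zero_le_one]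
    refine ContinuousOn.clm_comp ?_ continuousOn_const
    exact (σ.contDiffOn_localIntegrand p₀).continuousOn.comp (f := fun s : ℝ => (s, y))
      (by fun_prop) fun s hs => ⟨hs, hy⟩
  have h4 : localForm (E := DoubledSpace D) σ.β p₀ y =
      (∫ s in (0 : ℝ)..1, f s).comp (tmap (DoubledSpace D) e.symm y) := rfl
  rw [h4]
  have h5 := ContinuousLinearMap.intervalIntegral_comp_comm
    ((ContinuousLinearMap.compL ℝ (DoubledSpace D) (DoubledSpace D) ℝ).flip
      (tmap (DoubledSpace D) e.symm y)) hfc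
  simp only [ContinuousLinearMap.flip_apply, ContinuousLinearMap.compL_apply, hfs] at h5
  exact h5.symm

/-- The 2-form `φ₁^* d β`, where `d` is the exterior derivative along the leaves, as a bilinear
form on the model space. -/
def curvMap (q : M) : DoubledSpace D →L[ℝ] DoubledSpace D →L[ℝ] ℝ :=
  (extDer (E := DoubledSpace D) σ.β (σ.φ 1 q)).bilinearComp
    ((S.projMap ε (σ.φ 1 q)).comp (tmap (DoubledSpace D) (σ.φ 1) q))
    ((S.projMap ε (σ.φ 1 q)).comp (tmap (DoubledSpace D) (σ.φ 1) q))

theorem smoothForm_curvMap : SmoothForm σ.curvMap := by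
  refine (smoothForm_extDer σ.contDiffOn_localForm_β).pullback fun p => ?_
  have h1 : SmoothHom 𝓘(ℝ, DoubledSpace D) (fun p : M => p) (σ.φ 1)
      (fun q => tmap (DoubledSpace D) (σ.φ 1) q) univ p :=
    SmoothHom.tmap_const (σ.contMDiff_φ 1).contMDiffAt contMDiffWithinAt_id (mem_univ _)
  have h2 : SmoothHom 𝓘(ℝ, DoubledSpace D) (σ.φ 1) (σ.φ 1)
      (fun q => S.projMap ε (σ.φ 1 q)) univ p := by
    have h3 := S.smoothHom_projMap ε (σ.φ 1 p)
    have h4 := (σ.contMDiff_φ 1).contMDiffAt.contMDiffWithinAt (x := p) (s := univ)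
    exact ⟨h4, h4, h3.coord.comp p h4 fun _ _ => mem_univ _⟩
  exact h2.comp h1

theorem curvMap_Kmap (hε : ε * ε = 1) (q : M) (u v : DoubledSpace D) :
    σ.curvMap q u (S.Kmap q v) = ε * σ.curvMap q u v := by
  simp only [curvMap, ContinuousLinearMap.bilinearComp_apply, ContinuousLinearMap.comp_apply,
    σ.tmap_Kmap, S.projMap_Kmap hε, map_smul, smul_eq_mul]

/-- The diffeomorphism `φ₁` of a bisection. -/
def diffeo : Diffeomorph 𝓘(ℝ, DoubledSpace D) 𝓘(ℝ, DoubledSpace D) M M ∞ :=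
  σ.one_diffeo.choose

theorem coe_diffeo : ⇑σ.diffeo = σ.φ 1 := funext σ.one_diffeo.choose_spec

end LeafBisection

namespace DoubledBisection

variable {S : ParaHermitian D M} (σ : DoubledBisection S)

/-- The diffeomorphism underlying a doubled bisection. -/
def diffeo : Diffeomorph 𝓘(ℝ, DoubledSpace D) 𝓘(ℝ, DoubledSpace D) M M ∞ :=
  σ.fst.diffeo.trans σ.snd.diffeo

theorem coe_diffeo : ⇑σ.diffeo = σ.dot := by
  funext p
  simp [diffeo, dot, LeafBisection.coe_diffeo]

theorem bijective_dot : Function.Bijective σ.dot := by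
  rw [← coe_diffeo]
  exact σ.diffeo.bijective

theorem tmap_Kmap (p : M) (v : DoubledSpace D) :
    tmap (DoubledSpace D) σ.diffeo p (S.Kmap p v) =
      S.Kmap (σ.diffeo p) (tmap (DoubledSpace D) σ.diffeo p v) := by
  have h : (σ.diffeo : M → M) = fun q => σ.snd.φ 1 (σ.fst.φ 1 q) := σ.coe_diffeo
  rw [h, tmap_comp (σ.snd.mdifferentiableAt_φ _ _) (σ.fst.mdifferentiableAt_φ _ _)]
  simp only [ContinuousLinearMap.comp_apply, LeafBisection.tmap_Kmap]

end DoubledBisection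

end Bisections

section Shear

variable {D : ℕ} {M : Type*} [TopologicalSpace M] [ChartedSpace (DoubledSpace D) M]

/-! ### Diffeomorphisms preserving the para-complex structure -/

theorem tmap_symm_tmap (Φ : Diffeomorph 𝓘(ℝ, DoubledSpace D) 𝓘(ℝ, DoubledSpace D) M M ∞) (p : M)
    (v : DoubledSpace D) :
    tmap (DoubledSpace D) Φ.symm (Φ p) (tmap (DoubledSpace D) Φ p v) = v := by
  have h := tmap_comp (g := Φ.symm) (f := Φ) (p := p)
    (Φ.symm.contMDiff.mdifferentiable (by simp) _) (Φ.contMDiff.mdifferentiable (by simp) _)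
  simp only [Diffeomorph.symm_apply_apply, tmap_id] at h
  exact (DFunLike.congr_fun h v).symm

theorem tmap_tmap_symm (Φ : Diffeomorph 𝓘(ℝ, DoubledSpace D) 𝓘(ℝ, DoubledSpace D) M M ∞) (p : M)
    (v : DoubledSpace D) :
    tmap (DoubledSpace D) Φ (Φ.symm p) (tmap (DoubledSpace D) Φ.symm p v) = v :=
  tmap_symm_tmap Φ.symm p v

/-- The velocity of a path, as a vector of the model space. -/
def vel (γ : unitInterval → M) (t : unitInterval) : DoubledSpace D := velocity (D := D) γ t

/-- The covector of a point of the cotangent bundle, as a linear form on the model space. -/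
def covec (a : Cotangent D M) : DoubledSpace D →L[ℝ] ℝ := a.snd

theorem cotangent_ext {a b : Cotangent D M} (h : a.proj = b.proj)
    (h' : covec a = covec b) :
    a = b := by
  obtain ⟨p, θ⟩ := a
  obtain ⟨q, θ'⟩ := b
  obtain rfl : p = q := h
  obtain rfl : θ = θ' := h'
  rfl

variable [IsManifold 𝓘(ℝ, DoubledSpace D) ∞ M]

/-- The derivative of `Φ` commutes with the para-complex structure. -/
def CommutesK (S : ParaHermitian D M) (Φ : M → M) : Prop :=
  ∀ p v, tmap (DoubledSpace D) Φ p (S.Kmap p v) = S.Kmap (Φ p) (tmap (DoubledSpace D) Φ p v)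

theorem CommutesK.symm {S : ParaHermitian D M}
    {Φ : Diffeomorph 𝓘(ℝ, DoubledSpace D) 𝓘(ℝ, DoubledSpace D) M M ∞} (h : CommutesK S Φ) :
    CommutesK S Φ.symm := by
  intro p v
  have h1 := h (Φ.symm p) (tmap (DoubledSpace D) Φ.symm p v)
  rw [tmap_tmap_symm, Φ.apply_symm_apply] at h1
  rw [← h1]
  have h2 := tmap_symm_tmap Φ (Φ.symm p) (S.Kmap (Φ.symm p) (tmap (DoubledSpace D) Φ.symm p v))
  rwa [Φ.apply_symm_apply] at h2

theorem CommutesK.comp {S : ParaHermitian D M} {g f : M → M} (hg : CommutesK S g)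
    (hf : CommutesK S f) (hgd : MDifferentiable 𝓘(ℝ, DoubledSpace D) 𝓘(ℝ, DoubledSpace D) g)
    (hfd : MDifferentiable 𝓘(ℝ, DoubledSpace D) 𝓘(ℝ, DoubledSpace D) f) :
    CommutesK S (fun p => g (f p)) := by
  intro p v
  rw [tmap_comp (hgd _) (hfd _)]
  simp only [ContinuousLinearMap.comp_apply, hf p v, hg (f p)]

/-! ### Transporting and shearing cotangent paths -/

/-- The cotangent path with base path `Ψ ∘ γ` whose covectors are obtained from those of `(γ, θ)`
by transport along `Ψ` and by adding the contraction of the form `Ω` with the velocity. -/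
def shear (Ψ : Diffeomorph 𝓘(ℝ, DoubledSpace D) 𝓘(ℝ, DoubledSpace D) M M ∞)
    (Ω : M → DoubledSpace D →L[ℝ] DoubledSpace D →L[ℝ] ℝ) (c : unitInterval → Cotangent D M) :
    unitInterval → Cotangent D M := fun t =>
  ⟨Ψ (c t).proj, (ContinuousLinearMap.comp (covec (c t))
    (tmap (DoubledSpace D) Ψ.symm (Ψ (c t).proj)) +
    Ω (Ψ (c t).proj) (vel (D := D) (fun t => Ψ (c t).proj) t) : DoubledSpace D →L[ℝ] ℝ)⟩

variable {EN : Type*} [NormedAddCommGroup EN] [NormedSpace ℝ EN] {HN : Type*} [TopologicalSpace HN]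
  {J : ModelWithCorners ℝ EN HN} {N : Type*} [TopologicalSpace N] [ChartedSpace HN N]
  [IsManifold J 1 N] {s : Set N} {x₀ : N}

/-- Transport along `Ψ` and contraction of a smooth form with the vectors `u` preserve the
smoothness of a family of covectors, with an arbitrary manifold of parameters. -/
theorem contMDiffWithinAt_shear
    {Ψ : Diffeomorph 𝓘(ℝ, DoubledSpace D) 𝓘(ℝ, DoubledSpace D) M M ∞}
    {Ω : M → DoubledSpace D →L[ℝ] DoubledSpace D →L[ℝ] ℝ} (hΩ : SmoothForm Ω)
    {c : N → Cotangent D M} {u : N → DoubledSpace D} (hx₀ : x₀ ∈ s)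
    (hc : ContMDiffWithinAt J (𝓘(ℝ, DoubledSpace D).prod 𝓘(ℝ, DoubledSpace D →L[ℝ] ℝ)) ∞ c s x₀)
    (hu : SmoothVec J (fun x => Ψ (c x).proj) u s x₀) :
    ContMDiffWithinAt J (𝓘(ℝ, DoubledSpace D).prod 𝓘(ℝ, DoubledSpace D →L[ℝ] ℝ)) ∞
      (fun x => (⟨Ψ (c x).proj,
        (ContinuousLinearMap.comp (covec (c x))
          (tmap (DoubledSpace D) Ψ.symm (Ψ (c x).proj)) +
          Ω (Ψ (c x).proj) (u x) : DoubledSpace D →L[ℝ] ℝ)⟩ : Cotangent D M)) s x₀ := by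
  refine contMDiffWithinAt_cotangent.2 (SmoothCov.add ?_ (hΩ.apply hu))
  refine (contMDiffWithinAt_cotangent.1 hc).comp ?_
  refine (SmoothHom.tmap_const (G := Ψ.symm) Ψ.symm.contMDiff.contMDiffAt hu.base hx₀).congr ?_ ?_
  · exact .of_forall fun x => ⟨rfl, (Ψ.symm_apply_apply _).symm, rfl⟩
  · exact ⟨rfl, (Ψ.symm_apply_apply _).symm, rfl⟩

namespace IsLeafPath

variable {S : ParaHermitian D M} {ε : ℝ} {c : unitInterval → Cotangent D M}

theorem contMDiffOn_base (hc : IsLeafPath S ε c) : ContMDiffOn 𝓘(ℝ, ℝ) 𝓘(ℝ, DoubledSpace D) ∞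
    (IccExtend zero_le_one (fun t => (c t).proj)) (Icc 0 1) :=
  fun t ht => (contMDiffWithinAt_cotangent.1 (hc.smooth t ht)).base

theorem mdifferentiableWithinAt_base (hc : IsLeafPath S ε c) (t : unitInterval) :
    MDifferentiableWithinAt 𝓘(ℝ, ℝ) 𝓘(ℝ, DoubledSpace D)
      (IccExtend zero_le_one (fun t => (c t).proj)) (Icc 0 1) (t : ℝ) :=
  (hc.contMDiffOn_base t t.2).mdifferentiableWithinAt (by simp)

theorem velocity_comp (hc : IsLeafPath S ε c) {f : M → M}
    (hf : MDifferentiable 𝓘(ℝ, DoubledSpace D) 𝓘(ℝ, DoubledSpace D) f) (t : unitInterval) :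
    vel (D := D) (fun t => f (c t).proj) t =
      tmap (DoubledSpace D) f (c t).proj (vel (D := D) (fun t => (c t).proj) t) :=
  _root_.velocity_comp (γ := fun t => (c t).proj) (hf _) (hc.mdifferentiableWithinAt_base t)

/-- Transport along a diffeomorphism preserving `K`, followed by a shear along a form which is
compatible with `K`, maps leafwise cotangent paths to leafwise cotangent paths. -/
theorem shear (hc : IsLeafPath S ε c)
    {Ψ : Diffeomorph 𝓘(ℝ, DoubledSpace D) 𝓘(ℝ, DoubledSpace D) M M ∞} (hΨ : CommutesK S Ψ)
    {Ω : M → DoubledSpace D →L[ℝ] DoubledSpace D →L[ℝ] ℝ} (hΩ : SmoothForm Ω)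
    (hΩK : ∀ q u v, Ω q u (S.Kmap q v) = ε * Ω q u v) : IsLeafPath S ε (shear Ψ Ω c) where
  smooth := by
    intro t ht
    have hG : ContMDiffOn 𝓘(ℝ, ℝ) 𝓘(ℝ, DoubledSpace D) ∞
        (IccExtend zero_le_one (fun t => Ψ (c t).proj)) (Icc 0 1) :=
      Ψ.contMDiff.comp_contMDiffOn hc.contMDiffOn_base
    have hu := smoothVec_velocity (J := 𝓘(ℝ, ℝ)) (s := Icc (0 : ℝ) 1) (x₀ := t) (τ := fun r => r)
      (G := fun _ => IccExtend zero_le_one (fun t => Ψ (c t).proj))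
      (ContMDiffWithinAt.comp (t, t) (f := fun z : ℝ × ℝ => z.2) (hG t ht) contMDiffWithinAt_snd
        (show MapsTo _ (Icc (0 : ℝ) 1 ×ˢ Icc (0 : ℝ) 1) (Icc (0 : ℝ) 1) from fun z hz => hz.2))
      contMDiffWithinAt_id ht (mapsTo_id _)
    have h := contMDiffWithinAt_shear hΩ ht (hc.smooth t ht) hu
    have heq : ∀ r ∈ Icc (0 : ℝ) 1, IccExtend zero_le_one (_root_.shear Ψ Ω c) r =
        (⟨Ψ (IccExtend zero_le_one c r).proj,
        (ContinuousLinearMap.comp (covec (IccExtend zero_le_one c r))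
          (tmap (DoubledSpace D) Ψ.symm (Ψ (IccExtend zero_le_one c r).proj)) +
          Ω (Ψ (IccExtend zero_le_one c r).proj)
            ((mfderivWithin 𝓘(ℝ, ℝ) 𝓘(ℝ, DoubledSpace D)
              (IccExtend zero_le_one (fun t => Ψ (c t).proj)) (Icc 0 1) r :
                ℝ →L[ℝ] DoubledSpace D) 1) : DoubledSpace D →L[ℝ] ℝ)⟩ : Cotangent D M) := by
      intro r hr
      obtain ⟨r, rfl⟩ : ∃ r' : unitInterval, (r' : ℝ) = r := ⟨⟨r, hr⟩, rfl⟩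
      rw [IccExtend_val, IccExtend_val]
      rfl
    exact h.congr heq (heq t ht)
  tangent := by
    intro t
    have h1 := hc.velocity_comp (Ψ.contMDiff.mdifferentiable (by simp)) t
    have h2 : S.Kmap (c t).proj (vel (D := D) (fun t => (c t).proj) t) =
        ε • vel (D := D) (fun t => (c t).proj) t := hc.tangent t
    have h3 := hΨ (c t).proj (vel (D := D) (fun t => (c t).proj) t)
    rw [h2] at h3
    rw [map_smul] at h3
    rw [← h1] at h3
    exact h3.symm
  covector := by
    intro t (v : DoubledSpace D)
    have h1 := hΨ.symm (Ψ (c t).proj) v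
    rw [Ψ.symm_apply_apply] at h1
    have h2 : ∀ w : DoubledSpace D, (covec (c t))
      (S.Kmap (c t).proj w) = ε * (covec (c t)) w := hc.covector t
    change (covec (c t))
        (tmap (DoubledSpace D) Ψ.symm (Ψ (c t).proj) (S.Kmap (Ψ (c t).proj) v)) +
        Ω (Ψ (c t).proj) _ (S.Kmap (Ψ (c t).proj) v) =
      ε * ((covec (c t))
        (tmap (DoubledSpace D) Ψ.symm (Ψ (c t).proj) v) + Ω _ _ v)
    rw [h1, h2, hΩK, mul_add]

/-- A shear is undone by the inverse diffeomorphism and the opposite of the pulled back form. -/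
theorem shear_symm_shear (hc : IsLeafPath S ε c)
    {Ψ : Diffeomorph 𝓘(ℝ, DoubledSpace D) 𝓘(ℝ, DoubledSpace D) M M ∞}
    {Ω Ω' : M → DoubledSpace D →L[ℝ] DoubledSpace D →L[ℝ] ℝ}
    (hΩ' : ∀ q u v, Ω' q u v =
      -Ω (Ψ q) (tmap (DoubledSpace D) Ψ q u) (tmap (DoubledSpace D) Ψ q v)) :
    _root_.shear Ψ.symm Ω' (_root_.shear Ψ Ω c) = c := by
  funext t
  refine cotangent_ext (Ψ.symm_apply_apply _) ?_
  refine ContinuousLinearMap.ext fun v => ?_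
  have h0 : (fun t => Ψ.symm (_root_.shear Ψ Ω c t).proj) = fun t => (c t).proj :=
    funext fun t => Ψ.symm_apply_apply _
  have h1 := hc.velocity_comp (Ψ.contMDiff.mdifferentiable (by simp)) t
  have h2 := tmap_symm_tmap Ψ (c t).proj v
  change (covec (c t)) (tmap (DoubledSpace D) Ψ.symm (Ψ (c t).proj)
      (tmap (DoubledSpace D) Ψ (Ψ.symm (Ψ (c t).proj)) v)) +
    Ω (Ψ (c t).proj) (vel (D := D) (fun t => Ψ (c t).proj) t)
      (tmap (DoubledSpace D) Ψ (Ψ.symm (Ψ (c t).proj)) v) +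
    Ω' (Ψ.symm (Ψ (c t).proj)) (vel (D := D)
      (fun t => Ψ.symm (_root_.shear Ψ Ω c t).proj) t) v =
    (covec (c t)) v
  rw [h0, h1, hΩ', Ψ.symm_apply_apply, h2]
  simp

end IsLeafPath

namespace LeafBisection

variable {S : ParaHermitian D M} {ε : ℝ}

/-- The bisection whose paths are the sheared paths of `τ`. -/
def shear (τ : LeafBisection S ε)
    {Ψ : Diffeomorph 𝓘(ℝ, DoubledSpace D) 𝓘(ℝ, DoubledSpace D) M M ∞} (hΨ : CommutesK S Ψ)
    {Ω : M → DoubledSpace D →L[ℝ] DoubledSpace D →L[ℝ] ℝ} (hΩ : SmoothForm Ω)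
    (hΩK : ∀ q u v, Ω q u (S.Kmap q v) = ε * Ω q u v) : LeafBisection S ε where
  η := fun t p => _root_.shear Ψ Ω (fun t => τ.η t (Ψ.symm p)) t
  smooth := by
    rintro ⟨t, p⟩ hz
    set A := Icc (0 : ℝ) 1 ×ˢ (univ : Set M) with hA
    have hfst : ContMDiffAt (𝓘(ℝ, ℝ).prod 𝓘(ℝ, DoubledSpace D)) 𝓘(ℝ, ℝ) ∞
        (fun z : ℝ × M => z.1) (t, p) := contMDiffAt_fst
    have hmap : ContMDiffAt (𝓘(ℝ, ℝ).prod 𝓘(ℝ, DoubledSpace D))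
        (𝓘(ℝ, ℝ).prod 𝓘(ℝ, DoubledSpace D)) ∞
        (fun z : ℝ × M => (z.1, Ψ.symm z.2)) (t, p) :=
      hfst.prodMk (Ψ.symm.contMDiff.contMDiffAt.comp (t, p) contMDiffAt_snd)
    have hc := ContMDiffWithinAt.comp (t, p) (f := fun z : ℝ × M => (z.1, Ψ.symm z.2))
      (τ.smooth (t, Ψ.symm p) ⟨hz.1, mem_univ _⟩) hmap.contMDiffWithinAt
      (show MapsTo _ A A from fun z hz => ⟨hz.1, mem_univ _⟩)
    set G : ℝ × M → ℝ → M := fun z => IccExtend zero_le_one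
      (fun t => Ψ (τ.η t (Ψ.symm z.2)).proj) with hG
    have hGs : ContMDiffWithinAt ((𝓘(ℝ, ℝ).prod 𝓘(ℝ, DoubledSpace D)).prod 𝓘(ℝ, ℝ))
        𝓘(ℝ, DoubledSpace D) ∞ (fun w : (ℝ × M) × ℝ => G w.1 w.2) (A ×ˢ Icc 0 1) ((t, p), t) := by
      have h1 : ContMDiffAt ((𝓘(ℝ, ℝ).prod 𝓘(ℝ, DoubledSpace D)).prod 𝓘(ℝ, ℝ))
          (𝓘(ℝ, ℝ).prod 𝓘(ℝ, DoubledSpace D)) ∞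
          (fun w : (ℝ × M) × ℝ => (w.2, Ψ.symm w.1.2)) ((t, p), t) :=
        contMDiffAt_snd.prodMk ((Ψ.symm.contMDiff.comp contMDiff_snd).comp contMDiff_fst).contMDiffAt
      have h2 := ContMDiffWithinAt.comp ((t, p), t)
        (f := fun w : (ℝ × M) × ℝ => (w.2, Ψ.symm w.1.2))
        (τ.contMDiffOn_base (t, Ψ.symm p) ⟨hz.1, mem_univ _⟩) h1.contMDiffWithinAt
        (show MapsTo _ (A ×ˢ Icc (0 : ℝ) 1) A from fun w hw => ⟨hw.2, mem_univ _⟩)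
      exact Ψ.contMDiff.contMDiffAt.comp_contMDiffWithinAt ((t, p), t) h2
    have hu := smoothVec_velocity hGs hfst.contMDiffWithinAt hz fun z hz => hz.1
    have h := contMDiffWithinAt_shear hΩ hz hc hu
    have heq : ∀ z ∈ A, IccExtend zero_le_one
        (fun t p => _root_.shear Ψ Ω (fun t => τ.η t (Ψ.symm p)) t) z.1 z.2 =
        (⟨Ψ (IccExtend zero_le_one τ.η z.1 (Ψ.symm z.2)).proj,
        (ContinuousLinearMap.comp (covec (IccExtend zero_le_one τ.η z.1 (Ψ.symm z.2)))
          (tmap (DoubledSpace D) Ψ.symm (Ψ (IccExtend zero_le_one τ.η z.1 (Ψ.symm z.2)).proj)) +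
          Ω (Ψ (IccExtend zero_le_one τ.η z.1 (Ψ.symm z.2)).proj)
            ((mfderivWithin 𝓘(ℝ, ℝ) 𝓘(ℝ, DoubledSpace D) (G z) (Icc 0 1) z.1 :
                ℝ →L[ℝ] DoubledSpace D) 1) : DoubledSpace D →L[ℝ] ℝ)⟩ : Cotangent D M) := by
      rintro ⟨r, q⟩ hz
      obtain ⟨r, rfl⟩ : ∃ r' : unitInterval, (r' : ℝ) = r := ⟨⟨r, hz.1⟩, rfl⟩
      dsimp only
      rw [IccExtend_val, IccExtend_val]
      rfl
    exact h.congr heq (heq (t, p) hz)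
  isLeafPath := fun p => (τ.isLeafPath (Ψ.symm p)).shear hΨ hΩ hΩK
  zero := fun p => (congrArg Ψ (τ.zero (Ψ.symm p))).trans (Ψ.apply_symm_apply p)
  one_diffeo := ⟨(Ψ.symm.trans τ.diffeo).trans Ψ, fun p => by
    simp only [Diffeomorph.coe_trans, Function.comp_apply, τ.coe_diffeo]
    rfl⟩
  foliated := by
    intro t
    have h1 := Ψ.contMDiff.mdifferentiable (by simp)
    have h2 := Ψ.symm.contMDiff.mdifferentiable (by simp)
    have h3 : CommutesK S (τ.φ t) := τ.tmap_Kmap t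
    exact hΨ.comp (h3.comp hΨ.symm (τ.mdifferentiableAt_φ t) h2) h1
      fun p => (τ.mdifferentiableAt_φ t _).comp p (h2 p)

variable (σ : LeafBisection S ε)
  (Φ : Diffeomorph 𝓘(ℝ, DoubledSpace D) 𝓘(ℝ, DoubledSpace D) M M ∞)

/-- The form by which the product shears: the opposite of `φ₁^* d β`, transported along `Φ`. -/
def rackForm (q : M) : DoubledSpace D →L[ℝ] DoubledSpace D →L[ℝ] ℝ :=
  -(σ.curvMap (Φ.symm q)).bilinearComp (tmap (DoubledSpace D) Φ.symm q)
    (tmap (DoubledSpace D) Φ.symm q)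

theorem smoothForm_rackForm : SmoothForm (σ.rackForm Φ) :=
  (σ.smoothForm_curvMap.pullback fun _ => SmoothHom.tmap_const Φ.symm.contMDiff.contMDiffAt
    contMDiffWithinAt_id (mem_univ _)).neg

theorem rackForm_Kmap (hε : ε * ε = 1)
    {Φ : Diffeomorph 𝓘(ℝ, DoubledSpace D) 𝓘(ℝ, DoubledSpace D) M M ∞}
    (hΦ : CommutesK S Φ) (q : M) (u v : DoubledSpace D) :
    σ.rackForm Φ q u (S.Kmap q v) = ε * σ.rackForm Φ q u v := by
  have h := hΦ.symm q v
  simp only [rackForm, neg_apply, ContinuousLinearMap.bilinearComp_apply, h, σ.curvMap_Kmap hε,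
    mul_neg]

/-- A shear by `rackForm` satisfies the equation which defines the product. -/
theorem isRackTransform_shear {Φ : Diffeomorph 𝓘(ℝ, DoubledSpace D) 𝓘(ℝ, DoubledSpace D) M M ∞}
    {c : unitInterval → Cotangent D M} (hc : IsLeafPath S ε c) :
    IsRackTransform σ Φ c (_root_.shear Φ (σ.rackForm Φ) c) := by
  refine fun t => ⟨_, rfl, fun (v : DoubledSpace D) => ?_⟩
  have h1 := hc.velocity_comp (Φ.contMDiff.mdifferentiable (by simp)) t
  change (covec (c t)) (tmap (DoubledSpace D) Φ.symm (Φ (c t).proj)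
      (tmap (DoubledSpace D) Φ (c t).proj v)) +
    -σ.curvMap (Φ.symm (Φ (c t).proj)) (tmap (DoubledSpace D) Φ.symm (Φ (c t).proj)
      (vel (D := D) (fun t => Φ (c t).proj) t)) (tmap (DoubledSpace D) Φ.symm (Φ (c t).proj)
      (tmap (DoubledSpace D) Φ (c t).proj v)) =
    (covec (c t)) v -
      σ.curvMap (c t).proj (vel (D := D) (fun t => (c t).proj) t) v
  rw [h1, tmap_symm_tmap, tmap_symm_tmap, Φ.symm_apply_apply, sub_eq_add_neg]

/-- The product is determined by its defining equation. -/
theorem isRackTransform_unique {Φ : Diffeomorph 𝓘(ℝ, DoubledSpace D) 𝓘(ℝ, DoubledSpace D) M M ∞}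
    {c c₁ c₂ : unitInterval → Cotangent D M}
    (h₁ : IsRackTransform σ Φ c c₁) (h₂ : IsRackTransform σ Φ c c₂) : c₁ = c₂ := by
  funext t
  obtain ⟨θ₁, e₁, h₁⟩ := h₁ t
  obtain ⟨θ₂, e₂, h₂⟩ := h₂ t
  rw [e₁, e₂]
  refine cotangent_ext rfl (ContinuousLinearMap.ext fun v => ?_)
  have h3 := (h₁ (tmap (DoubledSpace D) Φ.symm (Φ (c t).proj) v)).trans
    (h₂ (tmap (DoubledSpace D) Φ.symm (Φ (c t).proj) v)).symm
  have h4 : ∀ w : DoubledSpace D, tmap (DoubledSpace D) Φ (c t).proj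
      (tmap (DoubledSpace D) Φ.symm (Φ (c t).proj) w) = w := by
    intro w
    have := tmap_tmap_symm Φ (Φ (c t).proj) w
    rwa [Φ.symm_apply_apply] at this
  have h5 := h4 v
  unfold tmap at h3 h5
  erw [h5] at h3
  exact h3

end LeafBisection

end Shear

section Commutation

variable {D : ℕ} {M : Type*} [TopologicalSpace M] [ChartedSpace (DoubledSpace D) M]

/-! ### Curves in the leaves, and the two families of leaves as a product structure -/

theorem eq_zero_of_eq_neg {F : Type*} [NormedAddCommGroup F] [NormedSpace ℝ F] {x : F}
    (h : x = -x) : x = 0 := by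
  have h1 : (2 : ℝ) • x = 0 := by
    rw [two_smul]
    nth_rewrite 1 [h]
    exact neg_add_cancel x
  simpa using h1

/-- A coordinate of a foliated chart which is annihilated by the velocity is constant. -/
theorem const_of_vel {γ : unitInterval → M}
    (hγ : ∀ t : unitInterval, MDifferentiableWithinAt 𝓘(ℝ, ℝ) 𝓘(ℝ, DoubledSpace D)
      (IccExtend zero_le_one γ) (Icc 0 1) (t : ℝ))
    {e : OpenPartialHomeomorph M (DoubledSpace D)}
    (he : e ∈ IsManifold.maximalAtlas 𝓘(ℝ, DoubledSpace D) ∞ M)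
    {F : Type*} [NormedAddCommGroup F] [NormedSpace ℝ F] (A : DoubledSpace D →L[ℝ] F)
    {a b : unitInterval} (hmem : ∀ t ∈ Icc a b, γ t ∈ e.source)
    (hA : ∀ t ∈ Icc a b, A (tmap (DoubledSpace D) e (γ t) (vel (D := D) γ t)) = 0) :
    ∀ t ∈ Icc a b, A (e (γ t)) = A (e (γ a)) := by
  set f : ℝ → F := fun r => A (e (IccExtend zero_le_one γ r)) with hf
  have hd : ∀ t ∈ Icc a b, HasDerivWithinAt f 0 (Icc 0 1) (t : ℝ) := by
    intro t ht
    have hval : IccExtend zero_le_one γ (t : ℝ) = γ t := IccExtend_val _ _ _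
    have h1 : HasMFDerivAt 𝓘(ℝ, DoubledSpace D) 𝓘(ℝ, DoubledSpace D) e
        (IccExtend zero_le_one γ (t : ℝ))
        (mfderiv 𝓘(ℝ, DoubledSpace D) 𝓘(ℝ, DoubledSpace D) e
          (IccExtend zero_le_one γ (t : ℝ))) := by
      refine MDifferentiableAt.hasMFDerivAt ?_
      rw [hval]
      exact (contMDiffAt_of_mem_maximalAtlas he (hmem t ht)).mdifferentiableAt (by simp)
    have h2 := (h1.comp_hasMFDerivWithinAt (t : ℝ) (hγ t).hasMFDerivWithinAt).hasFDerivWithinAt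
    have h3 := (A.hasFDerivAt.comp_hasFDerivWithinAt (t : ℝ) h2).hasDerivWithinAt
    have h4 := hA t ht
    refine h3.congr_deriv ?_
    rw [← h4]
    have h5 : ∀ p : M, p = γ t → A (tmap (DoubledSpace D) e p (vel (D := D) γ t)) =
        A (tmap (DoubledSpace D) e (γ t) (vel (D := D) γ t)) := by
      rintro p rfl; rfl
    exact h5 _ hval
  have hsub : Icc (a : ℝ) b ⊆ Icc 0 1 := Icc_subset_Icc a.2.1 b.2.2
  have hlift : ∀ r ∈ Icc (a : ℝ) b, HasDerivWithinAt f 0 (Icc 0 1) r := fun r hr =>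
    hd ⟨r, hsub hr⟩ ⟨hr.1, hr.2⟩
  have h := constant_of_has_deriv_right_zero (f := f) (a := (a : ℝ)) (b := (b : ℝ))
    (fun r hr => ((hlift r hr).continuousWithinAt).mono hsub)
    (fun r hr => ((hlift r ⟨hr.1, hr.2.le⟩).mono hsub).mono_of_mem_nhdsWithin
      (Filter.mem_of_superset (Icc_mem_nhdsGE hr.2) (Icc_subset_Icc hr.1 le_rfl)))
  intro t ht
  have h6 := h t ⟨ht.1, ht.2⟩
  simpa [hf] using h6

variable [IsManifold 𝓘(ℝ, DoubledSpace D) ∞ M]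

/-- A differentiable curve which is tangent to the eigenbundle of `K` with eigenvalue `ε`. -/
structure IsLeafCurve (S : ParaHermitian D M) (ε : ℝ) (γ : unitInterval → M) : Prop where
  mdiff : ∀ t : unitInterval, MDifferentiableWithinAt 𝓘(ℝ, ℝ) 𝓘(ℝ, DoubledSpace D)
    (IccExtend zero_le_one γ) (Icc 0 1) (t : ℝ)
  tangent : ∀ t, S.Kmap (γ t) (vel (D := D) γ t) = ε • vel (D := D) γ t

theorem IsLeafPath.isLeafCurve {S : ParaHermitian D M} {ε : ℝ} {c : unitInterval → Cotangent D M}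
    (hc : IsLeafPath S ε c) : IsLeafCurve S ε (fun t => (c t).proj) :=
  ⟨hc.mdifferentiableWithinAt_base, hc.tangent⟩

/-- Maps commuting with `K` preserve curves in leaves. -/
theorem IsLeafCurve.comp {S : ParaHermitian D M} {ε : ℝ} {γ : unitInterval → M}
    (hγ : IsLeafCurve S ε γ) {f : M → M} (hf : CommutesK S f)
    (hfd : MDifferentiable 𝓘(ℝ, DoubledSpace D) 𝓘(ℝ, DoubledSpace D) f) :
    IsLeafCurve S ε (fun t => f (γ t)) := by
  refine ⟨fun t => ?_, fun t => ?_⟩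
  · exact (hfd _).comp_mdifferentiableWithinAt (t : ℝ) (hγ.mdiff t)
  · have h : vel (D := D) (fun t => f (γ t)) t = tmap (DoubledSpace D) f (γ t)
        (vel (D := D) γ t) := velocity_comp (hfd _) (hγ.mdiff t)
    rw [h, ← hf, hγ.tangent, map_smul]

/-- A chart in which `K` is the standard para-complex structure. -/
def IsFoliatedChart (S : ParaHermitian D M) (e : OpenPartialHomeomorph M (DoubledSpace D)) : Prop :=
  e ∈ IsManifold.maximalAtlas 𝓘(ℝ, DoubledSpace D) ∞ M ∧ ∀ q ∈ e.source, ∀ v,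
    tmap (DoubledSpace D) e q (S.Kmap q v) = stdParaComplex D (tmap (DoubledSpace D) e q v)

/-- Along a curve in a `+` leaf the coordinates `x̃` of a foliated chart are constant. -/
theorem IsLeafCurve.snd_const {S : ParaHermitian D M} {γ : unitInterval → M}
    (hγ : IsLeafCurve S 1 γ) {e : OpenPartialHomeomorph M (DoubledSpace D)}
    (he : IsFoliatedChart S e) {a b : unitInterval} (hmem : ∀ t ∈ Icc a b, γ t ∈ e.source) :
    ∀ t ∈ Icc a b, (e (γ t)).2 = (e (γ a)).2 := by
  refine const_of_vel hγ.mdiff he.1 (ContinuousLinearMap.snd ℝ _ _) hmem fun t ht => ?_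
  have h := he.2 (γ t) (hmem t ht) (vel (D := D) γ t)
  rw [hγ.tangent, one_smul] at h
  have h2 := congrArg Prod.snd h
  simp only [stdParaComplex, ContinuousLinearMap.prod_apply, neg_apply] at h2
  exact eq_zero_of_eq_neg h2

/-- Along a curve in a `-` leaf the coordinates `x` of a foliated chart are constant. -/
theorem IsLeafCurve.fst_const {S : ParaHermitian D M} {γ : unitInterval → M}
    (hγ : IsLeafCurve S (-1) γ) {e : OpenPartialHomeomorph M (DoubledSpace D)}
    (he : IsFoliatedChart S e) {a b : unitInterval} (hmem : ∀ t ∈ Icc a b, γ t ∈ e.source) :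
    ∀ t ∈ Icc a b, (e (γ t)).1 = (e (γ a)).1 := by
  refine const_of_vel hγ.mdiff he.1 (ContinuousLinearMap.fst ℝ _ _) hmem fun t ht => ?_
  have h := he.2 (γ t) (hmem t ht) (vel (D := D) γ t)
  rw [hγ.tangent, neg_one_smul, map_neg] at h
  have h2 := congrArg Prod.fst h
  simp only [stdParaComplex, ContinuousLinearMap.prod_apply] at h2
  exact eq_zero_of_eq_neg h2.symm

/-- A rectangle whose horizontal sides are curves in `+` leaves and whose vertical sides are curves
in `-` leaves. -/
structure IsLeafRectangle (S : ParaHermitian D M) (F : unitInterval → unitInterval → M) : Prop where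
  continuous : Continuous (fun z : unitInterval × unitInterval => F z.1 z.2)
  horizontal : ∀ s, IsLeafCurve S 1 (fun t => F t s)
  vertical : ∀ t, IsLeafCurve S (-1) (fun s => F t s)

/-- In a foliated chart a leaf rectangle has the form `(x(t), x̃(s))`. -/
theorem IsLeafRectangle.chart_eq {S : ParaHermitian D M} {F : unitInterval → unitInterval → M}
    (hF : IsLeafRectangle S F) {e : OpenPartialHomeomorph M (DoubledSpace D)}
    (he : IsFoliatedChart S e) {a b c d : unitInterval}
    (hmem : ∀ t ∈ Icc a b, ∀ s ∈ Icc c d, F t s ∈ e.source) {t s : unitInterval}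
    (ht : t ∈ Icc a b) (hs : s ∈ Icc c d) :
    e (F t s) = ((e (F t c)).1, (e (F a s)).2) :=
  Prod.ext ((hF.vertical t).fst_const he (hmem t ht) s hs)
    ((hF.horizontal s).snd_const he (fun t ht => hmem t ht s hs) t ht)

/-- Leaf rectangles are determined by two adjacent sides. -/
theorem IsLeafRectangle.eq_of_sides [T2Space M] {S : ParaHermitian D M}
    {F G : unitInterval → unitInterval → M} (hF : IsLeafRectangle S F) (hG : IsLeafRectangle S G)
    (h₀ : ∀ s, F 0 s = G 0 s) (h₁ : ∀ t, F t 0 = G t 0) (t s : unitInterval) : F t s = G t s := by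
  -- each small square either lies in one foliated chart for both maps, or the maps differ
  -- everywhere on it
  let c : Option {e // IsFoliatedChart S e} → Set (unitInterval × unitInterval) := fun i =>
    match i with
    | none => {z | F z.1 z.2 ≠ G z.1 z.2}
    | some e => (fun z => F z.1 z.2) ⁻¹' e.1.source ∩ (fun z => G z.1 z.2) ⁻¹' e.1.source
  have hopen : ∀ i, IsOpen (c i) := by
    rintro (_ | e)
    · exact isOpen_ne_fun hF.continuous hG.continuous
    · exact (e.1.open_source.preimage hF.continuous).inter
        (e.1.open_source.preimage hG.continuous)
  have hcover : univ ⊆ ⋃ i, c i := by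
    intro z _
    by_cases hz : F z.1 z.2 = G z.1 z.2
    · obtain ⟨e, he, hmem, hK⟩ := S.doubled_foliations (F z.1 z.2)
      exact mem_iUnion.2 ⟨some ⟨e, he, hK⟩, hmem, by simpa [← hz] using hmem⟩
    · exact mem_iUnion.2 ⟨none, hz⟩
  obtain ⟨τ, hτ0, hτm, ⟨n, hn⟩, hsq⟩ :=
    exists_monotone_Icc_subset_open_cover_unitInterval_prod_self hopen hcover
  have hsquare : ∀ k l : ℕ, (∀ s ∈ Icc (τ l) (τ (l + 1)), F (τ k) s = G (τ k) s) →
      (∀ t ∈ Icc (τ k) (τ (k + 1)), F t (τ l) = G t (τ l)) →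
      ∀ t ∈ Icc (τ k) (τ (k + 1)), ∀ s ∈ Icc (τ l) (τ (l + 1)), F t s = G t s := by
    intro k l hleft hbot t ht s hs
    obtain ⟨i, hi⟩ := hsq k l
    rcases i with _ | ⟨e, he⟩
    · exact absurd (hleft _ ⟨le_rfl, hτm l.le_succ⟩)
        (hi (⟨⟨le_rfl, hτm k.le_succ⟩, ⟨le_rfl, hτm l.le_succ⟩⟩ :
          (τ k, τ l) ∈ Icc (τ k) (τ (k + 1)) ×ˢ Icc (τ l) (τ (l + 1))))
    · have hm : ∀ t ∈ Icc (τ k) (τ (k + 1)), ∀ s ∈ Icc (τ l) (τ (l + 1)),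
          F t s ∈ e.source ∧ G t s ∈ e.source := fun t ht s hs =>
        hi (⟨ht, hs⟩ : (t, s) ∈ Icc (τ k) (τ (k + 1)) ×ˢ Icc (τ l) (τ (l + 1)))
      refine e.injOn (hm t ht s hs).1 (hm t ht s hs).2 ?_
      rw [hF.chart_eq he (fun t ht s hs => (hm t ht s hs).1) ht hs,
        hG.chart_eq he (fun t ht s hs => (hm t ht s hs).2) ht hs, hbot t ht, hleft s hs]
  have hrows : ∀ k : ℕ, ∀ t ≤ τ k, ∀ s, F t s = G t s := by
    intro k
    induction k with
    | zero =>
      intro t ht s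
      rw [hτ0] at ht
      rw [le_antisymm ht t.2.1]
      exact h₀ s
    | succ k ihk =>
      have hcols : ∀ l : ℕ, ∀ t ∈ Icc (τ k) (τ (k + 1)), ∀ s ≤ τ l, F t s = G t s := by
        intro l
        induction l with
        | zero =>
          intro t _ s hs
          rw [hτ0] at hs
          rw [le_antisymm hs s.2.1]
          exact h₁ t
        | succ l ihl =>
          intro t ht s hs
          rcases le_total s (τ l) with h | h
          · exact ihl t ht s h
          · exact hsquare k l (fun s _ => ihk _ le_rfl s) (fun t ht => ihl t ht _ le_rfl) t ht s
              ⟨h, hs⟩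
      intro t ht s
      rcases le_total t (τ k) with h | h
      · exact ihk t h s
      · exact hcols n t ⟨h, ht⟩ s (by rw [hn n le_rfl]; exact s.2.2)
  exact hrows n t (by rw [hn n le_rfl]; exact t.2.2) s

/-! ### Bisections along the two foliations commute -/

namespace LeafBisection

variable {S : ParaHermitian D M} {ε : ℝ}

theorem continuous_φ (σ : LeafBisection S ε) :
    Continuous (fun z : unitInterval × M => σ.φ z.1 z.2) := by
  have h := σ.contMDiffOn_base.continuousOn.comp_continuous
    (f := fun z : unitInterval × M => ((z.1 : ℝ), z.2)) (by fun_prop)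
    (fun z => ⟨z.1.2, mem_univ _⟩)
  refine h.congr fun z => ?_
  simp [φ, Function.comp]

theorem surjective_φ_one (σ : LeafBisection S ε) : Function.Surjective (σ.φ 1) := by
  rw [← σ.coe_diffeo]
  exact σ.diffeo.surjective

theorem isLeafCurve_φ (σ : LeafBisection S ε) (p : M) : IsLeafCurve S ε (fun t => σ.φ t p) :=
  (σ.isLeafPath p).isLeafCurve

theorem commutesK_φ (σ : LeafBisection S ε) (t : unitInterval) : CommutesK S (σ.φ t) :=
  σ.tmap_Kmap t

/-- The base maps of bisections along the two foliations commute: for a point `p`, both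
`φ_t (φ̃_s p)` and `φ̃_s (φ_t p)` are leaf rectangles in `(t, s)`, with the same sides at `p`. -/
theorem φ_comm [T2Space M] (σ : LeafBisection S 1) (σ' : LeafBisection S (-1))
    (t s : unitInterval) (p : M) : σ.φ t (σ'.φ s p) = σ'.φ s (σ.φ t p) := by
  have hF : IsLeafRectangle S (fun t s => σ.φ t (σ'.φ s p)) :=
    ⟨σ.continuous_φ.comp (continuous_fst.prodMk
      ((σ'.continuous_φ.comp (continuous_snd.prodMk continuous_const)))),
      fun s => σ.isLeafCurve_φ _,
      fun t => (σ'.isLeafCurve_φ p).comp (σ.commutesK_φ t) (σ.mdifferentiableAt_φ t)⟩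
  have hG : IsLeafRectangle S (fun t s => σ'.φ s (σ.φ t p)) :=
    ⟨σ'.continuous_φ.comp (continuous_snd.prodMk
      ((σ.continuous_φ.comp (continuous_fst.prodMk continuous_const)))),
      fun s => (σ.isLeafCurve_φ p).comp (σ'.commutesK_φ s) (σ'.mdifferentiableAt_φ s),
      fun t => σ'.isLeafCurve_φ _⟩
  have hz : ∀ q, σ.φ 0 q = q := σ.zero
  have hz' : ∀ q, σ'.φ 0 q = q := σ'.zero
  exact hF.eq_of_sides hG (fun s => by simp only [hz]) (fun t => by simp only [hz']) t s

end LeafBisection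

end Commutation

section Rack

variable {D : ℕ} {M : Type*} [TopologicalSpace M] [ChartedSpace (DoubledSpace D) M]
  [IsManifold 𝓘(ℝ, DoubledSpace D) ∞ M] {S : ParaHermitian D M}

/-! ### The pre-rackoid of doubled cotangent paths -/

theorem DoubledCotangentPath.ext' {g g' : DoubledCotangentPath S} (h : g.fst = g'.fst)
    (h' : g.snd = g'.snd) : g = g' := by
  cases g; cases g'; cases h; cases h'; rfl

namespace DoubledBisection

variable (σ : DoubledBisection S)

theorem commutesK_diffeo : CommutesK S σ.diffeo := σ.tmap_Kmap

/-- The product of a doubled bisection with a doubled cotangent path. -/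
def act (g : DoubledCotangentPath S) : DoubledCotangentPath S where
  fst := shear σ.diffeo (σ.fst.rackForm σ.diffeo) g.fst
  snd := shear σ.diffeo (σ.snd.rackForm σ.diffeo) g.snd
  fst_isLeafPath := g.fst_isLeafPath.shear σ.commutesK_diffeo (σ.fst.smoothForm_rackForm _)
    (σ.fst.rackForm_Kmap (by norm_num) σ.commutesK_diffeo)
  snd_isLeafPath := g.snd_isLeafPath.shear σ.commutesK_diffeo (σ.snd.smoothForm_rackForm _)
    (σ.snd.rackForm_Kmap (by norm_num) σ.commutesK_diffeo)
  concat := congrArg σ.diffeo g.concat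

theorem isDoubledProduct_act : IsDoubledProduct S (fun σ => σ.act) := by
  intro σ g
  rw [← σ.coe_diffeo]
  exact ⟨σ.fst.isRackTransform_shear g.fst_isLeafPath,
    σ.snd.isRackTransform_shear g.snd_isLeafPath⟩

/-- The map which undoes the product with `σ`. -/
def actInv (g : DoubledCotangentPath S) : DoubledCotangentPath S where
  fst := shear σ.diffeo.symm σ.fst.curvMap g.fst
  snd := shear σ.diffeo.symm σ.snd.curvMap g.snd
  fst_isLeafPath := g.fst_isLeafPath.shear σ.commutesK_diffeo.symm σ.fst.smoothForm_curvMap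
    (σ.fst.curvMap_Kmap (by norm_num))
  snd_isLeafPath := g.snd_isLeafPath.shear σ.commutesK_diffeo.symm σ.snd.smoothForm_curvMap
    (σ.snd.curvMap_Kmap (by norm_num))
  concat := congrArg σ.diffeo.symm g.concat

theorem curvMap_eq_neg_rackForm {ε : ℝ} (σ : LeafBisection S ε)
    (Φ : Diffeomorph 𝓘(ℝ, DoubledSpace D) 𝓘(ℝ, DoubledSpace D) M M ∞) (q : M)
    (u v : DoubledSpace D) : σ.curvMap q u v =
      -σ.rackForm Φ (Φ q) (tmap (DoubledSpace D) Φ q u) (tmap (DoubledSpace D) Φ q v) := by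
  simp only [LeafBisection.rackForm, neg_apply, ContinuousLinearMap.bilinearComp_apply,
    tmap_symm_tmap, Φ.symm_apply_apply, neg_neg]

theorem actInv_act (g : DoubledCotangentPath S) : σ.actInv (σ.act g) = g :=
  DoubledCotangentPath.ext'
    (g.fst_isLeafPath.shear_symm_shear (curvMap_eq_neg_rackForm σ.fst σ.diffeo))
    (g.snd_isLeafPath.shear_symm_shear (curvMap_eq_neg_rackForm σ.snd σ.diffeo))

theorem act_actInv (g : DoubledCotangentPath S) : σ.act (σ.actInv g) = g :=
  DoubledCotangentPath.ext'
    (g.fst_isLeafPath.shear_symm_shear (Ψ := σ.diffeo.symm) fun _ _ _ => rfl)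
    (g.snd_isLeafPath.shear_symm_shear (Ψ := σ.diffeo.symm) fun _ _ _ => rfl)

theorem bijective_act : Function.Bijective σ.act :=
  Function.bijective_iff_has_inverse.2 ⟨σ.actInv, σ.actInv_act, σ.act_actInv⟩

theorem source_path (p : M) : (σ.path p).source = p := σ.fst.zero p

theorem isBisection_carrier :
    IsBisection DoubledCotangentPath.source DoubledCotangentPath.target σ.carrier := by
  refine ⟨⟨mapsTo_univ _ _, ?_, fun p _ => ⟨_, ⟨p, rfl⟩, σ.source_path p⟩⟩,
    ⟨mapsTo_univ _ _, ?_, fun p _ => ?_⟩⟩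
  · rintro _ ⟨p, rfl⟩ _ ⟨q, rfl⟩ h
    rw [source_path, source_path] at h
    rw [h]
  · rintro _ ⟨p, rfl⟩ _ ⟨q, rfl⟩ h
    rw [σ.bijective_dot.1 h]
  · obtain ⟨q, rfl⟩ := σ.bijective_dot.2 p
    exact ⟨_, ⟨q, rfl⟩, rfl⟩

/-- Two doubled bisections with the same underlying set have the same path through each point. -/
theorem path_eq_of_carrier_eq {σ σ' : DoubledBisection S} (h : σ.carrier = σ'.carrier) (p : M) :
    σ.path p = σ'.path p := by
  have h1 : σ.path p ∈ σ'.carrier := h ▸ ⟨p, rfl⟩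
  obtain ⟨q, hq⟩ := h1
  have h2 := congrArg DoubledCotangentPath.source hq
  rw [source_path, source_path] at h2
  rw [← hq, h2]

theorem _root_.LeafBisection.ext' {ε : ℝ} {σ σ' : LeafBisection S ε} (h : σ.η = σ'.η) :
    σ = σ' := by
  cases σ; cases σ'; cases h; rfl

/-- The first factor is read off from the paths through all points, and then the second factor,
because `φ₁` is surjective. -/
theorem carrier_injective : Function.Injective (carrier (S := S)) := by
  intro σ σ' h
  have h1 : σ.fst.η = σ'.fst.η := by
    funext t p
    exact congrFun (congrArg DoubledCotangentPath.fst (path_eq_of_carrier_eq h p)) t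
  have h2 : σ.fst = σ'.fst := LeafBisection.ext' h1
  have h3 : σ.snd.η = σ'.snd.η := by
    funext t p
    obtain ⟨q, rfl⟩ := σ.fst.surjective_φ_one p
    have h4 := congrFun (congrArg DoubledCotangentPath.snd (path_eq_of_carrier_eq h q)) t
    change σ.snd.η t (σ.fst.φ 1 q) = σ'.snd.η t (σ'.fst.φ 1 q) at h4
    rw [← h2] at h4
    exact h4
  cases σ; cases σ'; cases h2
  cases LeafBisection.ext' h3
  rfl

/-- The doubled bisection whose underlying set is the image of `τ` under the product with `σ`. -/
def image (τ : DoubledBisection S) : DoubledBisection S where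
  fst := τ.fst.shear σ.commutesK_diffeo (σ.fst.smoothForm_rackForm _)
    (σ.fst.rackForm_Kmap (by norm_num) σ.commutesK_diffeo)
  snd := τ.snd.shear σ.commutesK_diffeo (σ.snd.smoothForm_rackForm _)
    (σ.snd.rackForm_Kmap (by norm_num) σ.commutesK_diffeo)

theorem image_fst_φ (τ : DoubledBisection S) (t : unitInterval) (p : M) :
    (σ.image τ).fst.φ t (σ.diffeo p) = σ.diffeo (τ.fst.φ t p) :=
  congrArg (fun q => σ.diffeo (τ.fst.φ t q)) (σ.diffeo.symm_apply_apply p)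

theorem image_snd_φ (τ : DoubledBisection S) (t : unitInterval) (p : M) :
    (σ.image τ).snd.φ t (σ.diffeo p) = σ.diffeo (τ.snd.φ t p) :=
  congrArg (fun q => σ.diffeo (τ.snd.φ t q)) (σ.diffeo.symm_apply_apply p)

theorem path_image (τ : DoubledBisection S) (p : M) :
    (σ.image τ).path (σ.diffeo p) = σ.act (τ.path p) := by
  refine DoubledCotangentPath.ext' (funext fun t => ?_) (funext fun t => ?_)
  · change shear σ.diffeo (σ.fst.rackForm σ.diffeo)
      (fun t => τ.fst.η t (σ.diffeo.symm (σ.diffeo p))) t = _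
    rw [σ.diffeo.symm_apply_apply]
    rfl
  · change shear σ.diffeo (σ.snd.rackForm σ.diffeo)
      (fun t => τ.snd.η t (σ.diffeo.symm ((σ.image τ).fst.φ 1 (σ.diffeo p)))) t = _
    rw [image_fst_φ, σ.diffeo.symm_apply_apply]
    rfl

theorem carrier_image (τ : DoubledBisection S) : (σ.image τ).carrier = σ.act '' τ.carrier := by
  refine Subset.antisymm ?_ ?_
  · rintro _ ⟨p, rfl⟩
    obtain ⟨q, rfl⟩ := σ.diffeo.surjective p
    exact ⟨_, ⟨q, rfl⟩, (σ.path_image τ q).symm⟩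
  · rintro _ ⟨_, ⟨p, rfl⟩, rfl⟩
    exact ⟨_, σ.path_image τ p⟩

/-- The base maps of the image bisection are conjugate to those of `τ` by the first factor of `σ`
alone, since the second factor commutes with everything in sight. -/
theorem image_fst_φ_conj [T2Space M] (τ : DoubledBisection S) (t : unitInterval) (p : M) :
    (σ.image τ).fst.φ t (σ.fst.φ 1 p) = σ.fst.φ 1 (τ.fst.φ t p) := by
  obtain ⟨r, rfl⟩ := σ.snd.surjective_φ_one p
  have h := σ.image_fst_φ τ t r
  rw [LeafBisection.φ_comm]
  rw [σ.coe_diffeo] at h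
  change (σ.image τ).fst.φ t (σ.snd.φ 1 (σ.fst.φ 1 r)) =
    σ.snd.φ 1 (σ.fst.φ 1 (τ.fst.φ t r)) at h
  rw [h, ← LeafBisection.φ_comm, ← LeafBisection.φ_comm]

theorem image_snd_φ_conj [T2Space M] (τ : DoubledBisection S) (t : unitInterval) (p : M) :
    (σ.image τ).snd.φ t (σ.snd.φ 1 p) = σ.snd.φ 1 (τ.snd.φ t p) := by
  obtain ⟨r, rfl⟩ := σ.fst.surjective_φ_one p
  have h := σ.image_snd_φ τ t r
  rw [σ.coe_diffeo] at h
  rw [← LeafBisection.φ_comm σ.fst τ.snd]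
  exact h

theorem isPreRackoid : IsPreRackoid D DoubledCotangentPath.source DoubledCotangentPath.target
    carrier dot (fun σ : DoubledBisection S => σ.act) where
  source_surjective p := ⟨DoubledCotangentPath.unit S p, rfl⟩
  target_surjective p := ⟨DoubledCotangentPath.unit S p, rfl⟩
  isBisection := isBisection_carrier
  dot_smooth σ := by
    rw [← σ.coe_diffeo]
    exact σ.diffeo.contMDiff
  source_act σ g := by
    rw [← σ.coe_diffeo]
    rfl
  target_act σ g := by
    rw [← σ.coe_diffeo]
    rfl
  bijective := bijective_act

/-- The product is the only map satisfying its defining equation. -/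
theorem eq_act {act : DoubledBisection S → DoubledCotangentPath S → DoubledCotangentPath S}
    (h : IsDoubledProduct S act) : act = fun σ => σ.act := by
  funext σ g
  have h1 := h σ g
  have h2 := isDoubledProduct_act σ g
  rw [← σ.coe_diffeo] at h1 h2
  exact DoubledCotangentPath.ext' (σ.fst.isRackTransform_unique h1.1 h2.1)
    (σ.snd.isRackTransform_unique h1.2 h2.2)

end DoubledBisection

end Rack

section Model

variable {D : ℕ}

/-! ### The flat para-Hermitian space and its linear bisections -/

/-- The neutral pairing `⟨(x, x̃), (y, ỹ)⟩ = x · ỹ + x̃ · y`. -/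
def neutralForm (D : ℕ) : DoubledSpace D →L[ℝ] DoubledSpace D →L[ℝ] ℝ :=
  (innerSL ℝ).bilinearComp (ContinuousLinearMap.fst ℝ _ _) (ContinuousLinearMap.snd ℝ _ _) +
    (innerSL ℝ).bilinearComp (ContinuousLinearMap.snd ℝ _ _) (ContinuousLinearMap.fst ℝ _ _)

theorem neutralForm_apply (u v : DoubledSpace D) :
    neutralForm D u v = inner ℝ u.1 v.2 + inner ℝ u.2 v.1 := rfl

theorem continuousLinearMapAt_cotangent_model (p₀ p : DoubledSpace D) (L : DoubledSpace D →L[ℝ] ℝ) :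
    (trivializationAt (DoubledSpace D →L[ℝ] ℝ) (fun p : DoubledSpace D =>
      TangentSpace 𝓘(ℝ, DoubledSpace D) p →L[ℝ] ℝ) p₀).continuousLinearMapAt ℝ p L = L := by
  have hp : p ∈ (trivializationAt (DoubledSpace D →L[ℝ] ℝ) (fun p : DoubledSpace D =>
      TangentSpace 𝓘(ℝ, DoubledSpace D) p →L[ℝ] ℝ) p₀).baseSet := by
    rw [hom_trivializationAt_baseSet]
    simp [chartAt_self_eq]
  have h := Trivialization.coe_linearMapAt_of_mem (R := ℝ)
    (trivializationAt (DoubledSpace D →L[ℝ] ℝ) (fun p : DoubledSpace D =>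
      TangentSpace 𝓘(ℝ, DoubledSpace D) p →L[ℝ] ℝ) p₀) hp
  refine (congrFun h L).trans ?_
  have h2 : L.comp (fromChart (DoubledSpace D) p₀ p) = L := by
    rw [fromChart_model, ContinuousLinearMap.comp_id]
  refine Eq.trans ?_ h2
  rw [hom_trivializationAt_apply]
  unfold ContinuousLinearMap.inCoordinates
  erw [Trivial.continuousLinearMapAt_trivialization]
  rfl

/-- A constant bilinear form is a smooth section, as the bundles of the model space are trivial. -/
theorem contMDiff_const_bilinear (B : DoubledSpace D →L[ℝ] DoubledSpace D →L[ℝ] ℝ) :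
    ContMDiff 𝓘(ℝ, DoubledSpace D)
      (𝓘(ℝ, DoubledSpace D).prod 𝓘(ℝ, DoubledSpace D →L[ℝ] DoubledSpace D →L[ℝ] ℝ)) ∞
      (fun p : DoubledSpace D => TotalSpace.mk' (DoubledSpace D →L[ℝ] DoubledSpace D →L[ℝ] ℝ)
        (E := fun p : DoubledSpace D => TangentSpace 𝓘(ℝ, DoubledSpace D) p →L[ℝ]
          TangentSpace 𝓘(ℝ, DoubledSpace D) p →L[ℝ] ℝ) p B) := by
  intro p₀
  rw [contMDiffAt_hom_bundle]
  refine ⟨contMDiffAt_id, ?_⟩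
  refine (contMDiffAt_const (c := B)).congr_of_eventuallyEq (.of_forall fun p => ?_)
  refine ContinuousLinearMap.ext fun u => ?_
  refine (continuousLinearMapAt_cotangent_model p₀ p _).trans ?_
  exact congrArg B (DFunLike.congr_fun (fromChart_model p₀ p) u)

/-- The flat para-Hermitian structure of `ℝ^D × ℝ^D`. -/
def flatParaHermitian (D : ℕ) : ParaHermitian D (DoubledSpace D) where
  K := fun _ => stdParaComplex D
  K_sq := fun p (v : DoubledSpace D) => Prod.ext rfl (neg_neg v.2)
  metric := fun _ => neutralForm D
  metric_smooth := contMDiff_const_bilinear _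
  metric_symm := fun _ (u v : DoubledSpace D) => by
    change neutralForm D u v = neutralForm D v u
    rw [neutralForm_apply, neutralForm_apply, real_inner_comm u.1, real_inner_comm u.2, add_comm]
  metric_nondegenerate := fun _ (u : DoubledSpace D) h => by
    have h1 : neutralForm D u (u.2, u.1) = 0 := h _
    rw [neutralForm_apply] at h1
    dsimp only at h1
    have h2 := real_inner_self_nonneg (x := u.1)
    have h3 := real_inner_self_nonneg (x := u.2)
    exact Prod.ext ((inner_self_eq_zero (𝕜 := ℝ)).1 (by linarith))
      ((inner_self_eq_zero (𝕜 := ℝ)).1 (by linarith))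
  metric_K := fun _ (u v : DoubledSpace D) => by
    change neutralForm D (u.1, -u.2) (v.1, -v.2) = -neutralForm D u v
    simp only [neutralForm_apply, inner_neg_left, inner_neg_right]
    ring
  doubled_foliations := fun p => by
    refine ⟨chartAt (DoubledSpace D) p, IsManifold.chart_mem_maximalAtlas p,
      mem_chart_source _ p, fun q _ v => ?_⟩
    rw [chartAt_self_eq]
    have h : mfderiv 𝓘(ℝ, DoubledSpace D) 𝓘(ℝ, DoubledSpace D)
        (OpenPartialHomeomorph.refl (DoubledSpace D)) q = ContinuousLinearMap.id ℝ _ := mfderiv_id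
    rw [h]
    rfl

/-- A straight line in the flat space, carrying a constant covector. -/
def linePath (p u : DoubledSpace D) (θ : DoubledSpace D →L[ℝ] ℝ) :
    unitInterval → Cotangent D (DoubledSpace D) :=
  fun t => ⟨p + (t : ℝ) • u, θ⟩

theorem vel_line (p u : DoubledSpace D) (t : unitInterval) :
    vel (D := D) (fun t : unitInterval => p + (t : ℝ) • u) t = u := by
  have h1 : HasFDerivWithinAt (fun r : ℝ => p + r • u)
      ((ContinuousLinearMap.id ℝ ℝ).smulRight u) (Icc 0 1) (t : ℝ) :=
    ((((hasFDerivAt_id (𝕜 := ℝ) (t : ℝ)).smul_const u).const_add p)).hasFDerivWithinAt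
  have h2 : ∀ r ∈ Icc (0 : ℝ) 1, IccExtend zero_le_one
      (fun t : unitInterval => p + (t : ℝ) • u) r = p + r • u := fun r hr => by
    rw [IccExtend_of_mem _ _ hr]
  have h3 := (h1.congr h2 (h2 _ t.2)).hasMFDerivWithinAt.mfderivWithin
    (uniqueDiffOn_Icc zero_lt_one _ t.2).uniqueMDiffWithinAt
  unfold vel velocity
  rw [h3]
  exact one_smul ℝ u

theorem contMDiffOn_model_cotangent {EN : Type*} [NormedAddCommGroup EN] [NormedSpace ℝ EN]
    {HN : Type*} [TopologicalSpace HN] {J : ModelWithCorners ℝ EN HN} {N : Type*}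
    [TopologicalSpace N] [ChartedSpace HN N] {s : Set N} {f : N → DoubledSpace D}
    {θ : N → DoubledSpace D →L[ℝ] ℝ} (hf : ContMDiff J 𝓘(ℝ, DoubledSpace D) ∞ f)
    (hθ : ContMDiff J 𝓘(ℝ, DoubledSpace D →L[ℝ] ℝ) ∞ θ) :
    ContMDiffOn J (𝓘(ℝ, DoubledSpace D).prod 𝓘(ℝ, DoubledSpace D →L[ℝ] ℝ)) ∞
      (fun x => (⟨f x, θ x⟩ : Cotangent D (DoubledSpace D))) s := by
  refine fun x _ => contMDiffWithinAt_cotangent.2 ⟨hf.contMDiffAt.contMDiffWithinAt, ?_⟩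
  simp only [fromChart_model, ContinuousLinearMap.comp_id]
  exact hθ.contMDiffAt.contMDiffWithinAt

theorem isLeafPath_linePath {ε : ℝ} {u : DoubledSpace D} {θ : DoubledSpace D →L[ℝ] ℝ}
    (p : DoubledSpace D) (hu : stdParaComplex D u = ε • u)
    (hθ : ∀ v, θ (stdParaComplex D v) = ε * θ v) :
    IsLeafPath (flatParaHermitian D) ε (linePath p u θ) where
  smooth := by
    have h : ContMDiff 𝓘(ℝ, ℝ) 𝓘(ℝ, DoubledSpace D) ∞ (fun r : ℝ => p + r • u) :=
      (contDiff_const.add (contDiff_id.smul contDiff_const)).contMDiff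
    refine (contMDiffOn_model_cotangent h (contMDiff_const (c := θ))).congr fun r hr => ?_
    rw [IccExtend_of_mem _ _ hr]
    rfl
  tangent := fun t => by
    change stdParaComplex D (vel (D := D) (fun t : unitInterval => p + (t : ℝ) • u) t) =
      ε • vel (D := D) (fun t : unitInterval => p + (t : ℝ) • u) t
    rw [vel_line, hu]
  covector := fun _ => hθ

/-- A linear map and a family of covectors depending linearly on the point, both compatible with
the `ε`-eigenbundle, such that `p ↦ p + A p` is invertible. -/
structure IsLeafwiseLinear (ε : ℝ) (A : DoubledSpace D →L[ℝ] DoubledSpace D)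
    (α : DoubledSpace D →L[ℝ] DoubledSpace D →L[ℝ] ℝ) : Prop where
  K_map : ∀ v, stdParaComplex D (A v) = ε • A v
  map_K : ∀ v, A (stdParaComplex D v) = ε • A v
  form_K : ∀ p v, α p (stdParaComplex D v) = ε * α p v
  invertible : ∃ B : DoubledSpace D →L[ℝ] DoubledSpace D,
    (∀ v, B (v + A v) = v) ∧ ∀ v, B v + A (B v) = v

theorem tmap_add_smul (A : DoubledSpace D →L[ℝ] DoubledSpace D) (r : ℝ) (p : DoubledSpace D) :
    tmap (DoubledSpace D) (fun q => q + r • A q) p =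
      ContinuousLinearMap.id ℝ (DoubledSpace D) + r • A := by
  rw [tmap_eq_fderiv]
  exact ((hasFDerivAt_id (𝕜 := ℝ) p).add (A.hasFDerivAt.const_smul r)).fderiv

/-- The bisection which moves `p` along the straight line to `p + A p`, with covector `α p`. -/
def linearBisection {ε : ℝ} {A : DoubledSpace D →L[ℝ] DoubledSpace D}
    {α : DoubledSpace D →L[ℝ] DoubledSpace D →L[ℝ] ℝ} (h : IsLeafwiseLinear ε A α) :
    LeafBisection (flatParaHermitian D) ε where
  η := fun t p => linePath p (A p) (α p) t
  smooth := by
    have hfst : ContMDiff (𝓘(ℝ, ℝ).prod 𝓘(ℝ, DoubledSpace D)) 𝓘(ℝ, ℝ) ∞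
      (fun z : ℝ × DoubledSpace D => z.1) := contMDiff_fst
    have hsnd : ContMDiff (𝓘(ℝ, ℝ).prod 𝓘(ℝ, DoubledSpace D)) 𝓘(ℝ, DoubledSpace D) ∞
      (fun z : ℝ × DoubledSpace D => z.2) := contMDiff_snd
    have h1 := hsnd.add (hfst.smul (A.contMDiff.comp hsnd))
    refine (contMDiffOn_model_cotangent h1 (α.contMDiff.comp hsnd)).congr fun z hz => ?_
    rw [IccExtend_of_mem _ _ hz.1]
    rfl
  isLeafPath := fun p => isLeafPath_linePath p (h.K_map p) (h.form_K p)
  zero := fun p => by simp [linePath]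
  one_diffeo := by
    obtain ⟨B, h1, h2⟩ := h.invertible
    refine ⟨⟨⟨fun p => p + A p, B, h1, h2⟩, ?_, B.contMDiff⟩, fun p => ?_⟩
    · exact (contDiff_id.add A.contDiff).contMDiff
    · change p + A p = p + (1 : ℝ) • A p
      rw [one_smul]
  foliated := fun t p (v : DoubledSpace D) => by
    change tmap (DoubledSpace D) (fun q => q + (t : ℝ) • A q) p (stdParaComplex D v) =
      stdParaComplex D (tmap (DoubledSpace D) (fun q => q + (t : ℝ) • A q) p v)
    rw [tmap_add_smul]
    simp [h.K_map, h.map_K]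

/-- The projection `(x, x̃) ↦ (x, 0)`. -/
def horiz (D : ℕ) : DoubledSpace D →L[ℝ] DoubledSpace D :=
  (ContinuousLinearMap.fst ℝ _ _).prod 0

theorem horiz_horiz (v : DoubledSpace D) : horiz D (horiz D v) = horiz D v := rfl

/-- A bilinear form which only involves the coordinates `x`. -/
def IsHorizontal (α : DoubledSpace D →L[ℝ] DoubledSpace D →L[ℝ] ℝ) : Prop :=
  ∀ u v, α (horiz D u) (horiz D v) = α u v

theorem IsHorizontal.apply_left {α : DoubledSpace D →L[ℝ] DoubledSpace D →L[ℝ] ℝ}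
    (hα : IsHorizontal α) (u v : DoubledSpace D) : α (horiz D u) v = α u v := by
  rw [← hα, horiz_horiz, hα]

theorem IsHorizontal.apply_right {α : DoubledSpace D →L[ℝ] DoubledSpace D →L[ℝ] ℝ}
    (hα : IsHorizontal α) (u v : DoubledSpace D) : α u (horiz D v) = α u v := by
  rw [← hα, horiz_horiz, hα]

theorem isLeafwiseLinear_horiz {c : ℝ} (hc : 1 + c ≠ 0)
    {α : DoubledSpace D →L[ℝ] DoubledSpace D →L[ℝ] ℝ} (hα : IsHorizontal α) :
    IsLeafwiseLinear 1 (c • horiz D) α where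
  K_map v := by simp [stdParaComplex, horiz]
  map_K v := by simp [stdParaComplex, horiz]
  form_K p v := by
    rw [← hα.apply_right, one_mul, ← hα.apply_right p v]
    rfl
  invertible := by
    refine ⟨ContinuousLinearMap.id ℝ _ - (c / (1 + c)) • horiz D, fun v => ?_, fun v => ?_⟩
    · have h : c - c / (1 + c) - c / (1 + c) * c = 0 := by field_simp; ring
      refine Prod.ext ?_ (by simp [horiz])
      have : v.1 + c • v.1 - (c / (1 + c)) • (v.1 + c • v.1) =
          v.1 + (c - c / (1 + c) - c / (1 + c) * c) • v.1 := by module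
      rw [h, zero_smul, add_zero] at this
      exact this
    · have h : c - c / (1 + c) - c * (c / (1 + c)) = 0 := by field_simp; ring
      refine Prod.ext ?_ (by simp [horiz])
      have : v.1 - (c / (1 + c)) • v.1 + c • (v.1 - (c / (1 + c)) • v.1) =
          v.1 + (c - c / (1 + c) - c * (c / (1 + c))) • v.1 := by module
      rw [h, zero_smul, add_zero] at this
      exact this

theorem isLeafwiseLinear_zero (ε : ℝ) :
    IsLeafwiseLinear ε (0 : DoubledSpace D →L[ℝ] DoubledSpace D) 0 :=
  ⟨fun v => by simp, fun v => by simp, fun p v => by simp, ContinuousLinearMap.id ℝ _,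
    fun v => by simp, fun v => by simp⟩

/-- If `α p ∘ A = c • α p`, then `β p = ∫₀¹ (1 + c s) α p ds`. -/
theorem β_linearBisection {ε c : ℝ} {A : DoubledSpace D →L[ℝ] DoubledSpace D}
    {α : DoubledSpace D →L[ℝ] DoubledSpace D →L[ℝ] ℝ} (h : IsLeafwiseLinear ε A α)
    (hc : ∀ p v, α p (A v) = c * α p v) (p : DoubledSpace D) :
    ((linearBisection h).β p : DoubledSpace D →L[ℝ] ℝ) = (1 + c / 2) • α p := by
  have h1 : ∀ s ∈ Icc (0 : ℝ) 1, IccExtend zero_le_one (fun s : unitInterval =>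
      ((((linearBisection h).η s p).snd.comp
        (mfderiv 𝓘(ℝ, DoubledSpace D) 𝓘(ℝ, DoubledSpace D) ((linearBisection h).φ s) p) :
          DoubledSpace D →L[ℝ] ℝ))) s = (1 + c * s) • α p := by
    intro s hs
    rw [IccExtend_of_mem _ _ hs]
    change (α p).comp (tmap (DoubledSpace D) (fun q => q + s • A q) p) = _
    rw [tmap_add_smul]
    ext v
    · simp [hc]; ring
    · simp [hc]; ring
  unfold LeafBisection.β
  rw [intervalIntegral.integral_congr (g := fun s : ℝ => (1 + c * s) • α p)
    (by rw [uIcc_of_le zero_le_one]; exact h1), intervalIntegral.integral_smul_const]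
  congr 1
  rw [intervalIntegral.integral_add (by simp)
      (Continuous.intervalIntegrable (by fun_prop : Continuous fun x : ℝ => c * x) _ _),
    intervalIntegral.integral_const_mul]
  simp
  ring

/-- The exterior derivative of a 1-form with linear coefficients on the model space. -/
theorem extDer_linear (B : DoubledSpace D →L[ℝ] DoubledSpace D →L[ℝ] ℝ) (p : DoubledSpace D) :
    extDer (E := DoubledSpace D) (fun p => B p) p = B - B.flip := by
  have h1 : localForm (E := DoubledSpace D) (fun p => B p) p = B := by
    funext y
    have h2 : tmap (DoubledSpace D) (extChartAt 𝓘(ℝ, DoubledSpace D) p).symm y =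
        ContinuousLinearMap.id ℝ _ := by
      simp only [mfld_simps]
      exact tmap_id y
    rw [localForm, h2, ContinuousLinearMap.comp_id]
    simp only [mfld_simps, chartAt_self_eq]
  have h3 : tmap (DoubledSpace D) (extChartAt 𝓘(ℝ, DoubledSpace D) p) p =
      ContinuousLinearMap.id ℝ _ := by
    simp only [mfld_simps]
    exact tmap_id p
  rw [extDer, h1, h3, B.fderiv]
  rfl

/-- In the flat space `d` is the exterior derivative in the coordinates `x` alone. -/
theorem projMap_one (p v : DoubledSpace D) : (flatParaHermitian D).projMap 1 p v = horiz D v := by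
  change (2⁻¹ : ℝ) • (v + (1 : ℝ) • stdParaComplex D v) = horiz D v
  refine Prod.ext ?_ ?_
  · simp [stdParaComplex, horiz, ← two_smul ℝ]
  · simp [stdParaComplex, horiz]

/-- The bisection which moves along the straight lines `p + t c (x, 0)`, where `p = (x, x̃)`, with
covectors `α p`, and then stays constant. -/
def stretch {c : ℝ} (hc : 1 + c ≠ 0) {α : DoubledSpace D →L[ℝ] DoubledSpace D →L[ℝ] ℝ}
    (hα : IsHorizontal α) : DoubledBisection (flatParaHermitian D) where
  fst := linearBisection (isLeafwiseLinear_horiz hc hα)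
  snd := linearBisection (isLeafwiseLinear_zero (-1))

section Stretch

variable {c : ℝ} (hc : 1 + c ≠ 0) {α : DoubledSpace D →L[ℝ] DoubledSpace D →L[ℝ] ℝ}
  (hα : IsHorizontal α)

theorem stretch_fst_φ_one : (stretch hc hα).fst.φ 1 = fun p => p + c • horiz D p := by
  funext p
  change p + (1 : ℝ) • c • horiz D p = _
  rw [one_smul]

theorem stretch_dot : (stretch hc hα).dot = fun p => p + c • horiz D p := by
  funext p
  unfold DoubledBisection.dot
  rw [stretch_fst_φ_one]
  change p + c • horiz D p + (1 : ℝ) • (0 : DoubledSpace D) = _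
  rw [smul_zero, add_zero]

/-- The factor `1 + c / 2` is the mean value of `1 + c s`, and `(1 + c)²` comes from the pullback by
`φ₁`. -/
theorem curvMap_stretch (q u v : DoubledSpace D) : (stretch hc hα).fst.curvMap q u v =
    (1 + c / 2) * (1 + c) ^ 2 * (α u v - α v u) := by
  have h1 : (stretch hc hα).fst.β = fun p => ((1 + c / 2) • α) p := by
    funext p
    exact β_linearBisection (isLeafwiseLinear_horiz hc hα)
      (fun p v => by simp [hα.apply_right]) p
  have h2 : ∀ w, horiz D (tmap (DoubledSpace D) ((stretch hc hα).fst.φ 1) q w) =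
      (1 + c) • horiz D w := by
    intro w
    rw [stretch_fst_φ_one, tmap_add_smul]
    simp [horiz_horiz, add_smul]
  unfold LeafBisection.curvMap
  have h3 : extDer (E := DoubledSpace D) (stretch hc hα).fst.β ((stretch hc hα).fst.φ 1 q) =
      (1 + c / 2) • α - ((1 + c / 2) • α).flip := by
    rw [h1]
    exact extDer_linear _ _
  rw [h3]
  simp only [ContinuousLinearMap.bilinearComp_apply, ContinuousLinearMap.comp_apply, projMap_one,
    h2]
  simp [hα.apply_left, hα.apply_right]
  ring

/-- The doubled path which runs along a straight line, and then stays constant. -/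
def lineThenConst (p : DoubledSpace D) {u : DoubledSpace D} {θ : DoubledSpace D →L[ℝ] ℝ}
    (hu : horiz D u = u) (hθ : ∀ v, θ (horiz D v) = θ v) :
    DoubledCotangentPath (flatParaHermitian D) where
  fst := linePath p u θ
  snd := linePath (p + u) 0 0
  fst_isLeafPath := isLeafPath_linePath p (by rw [← hu]; simp [stdParaComplex, horiz]) fun v => by
    rw [← hθ, one_mul, ← hθ v]
    rfl
  snd_isLeafPath := isLeafPath_linePath _ (by simp) fun v => by simp
  concat := by
    change p + (1 : ℝ) • u = p + u + (0 : ℝ) • (0 : DoubledSpace D)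
    rw [one_smul, smul_zero, add_zero]

/-- The covector of the product of `stretch` with a straight line of velocity `u` and covector `θ`.
It is determined on horizontal vectors, where the derivative of the stretch is `1 + c`. -/
def stretchCovector (c : ℝ) (α : DoubledSpace D →L[ℝ] DoubledSpace D →L[ℝ] ℝ)
    (u : DoubledSpace D) (θ : DoubledSpace D →L[ℝ] ℝ) : DoubledSpace D →L[ℝ] ℝ :=
  (1 + c)⁻¹ • (θ - ((1 + c / 2) * (1 + c) ^ 2) • (α u - α.flip u))

theorem IsHorizontal.stretchCovector (hα : IsHorizontal α) (u : DoubledSpace D)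
    {θ : DoubledSpace D →L[ℝ] ℝ}
    (hθ : ∀ v, θ (horiz D v) = θ v) (v : DoubledSpace D) :
    stretchCovector c α u θ (horiz D v) = stretchCovector c α u θ v := by
  simp [_root_.stretchCovector, hθ, hα.apply_left, hα.apply_right]

/-- The product of a stretch with a straight line is a straight line with a constant covector, as
the 2-form of a stretch has constant coefficients. -/
theorem act_lineThenConst (p : DoubledSpace D) {u : DoubledSpace D} {θ : DoubledSpace D →L[ℝ] ℝ}
    (hu : horiz D u = u) (hθ : ∀ v, θ (horiz D v) = θ v) :
    (stretch hc hα).act (lineThenConst p hu hθ) =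
      lineThenConst (p + c • horiz D p) (u := (1 + c) • u) (by rw [map_smul, hu])
        (hα.stretchCovector (c := c) u hθ) := by
  have h := DoubledBisection.isDoubledProduct_act (stretch hc hα) (lineThenConst p hu hθ)
  rw [← DoubledBisection.coe_diffeo] at h
  have hd : ⇑(stretch hc hα).diffeo = fun p => p + c • horiz D p := by
    rw [DoubledBisection.coe_diffeo, stretch_dot]
  refine DoubledCotangentPath.ext'
    (LeafBisection.isRackTransform_unique _ h.1 fun t => ⟨stretchCovector c α u θ, ?_, ?_⟩)
    (LeafBisection.isRackTransform_unique _ h.2 fun t => ⟨0, ?_, ?_⟩)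
  · refine cotangent_ext ?_ rfl
    rw [hd]
    change p + c • horiz D p + (t : ℝ) • (1 + c) • u =
      p + (t : ℝ) • u + c • horiz D (p + (t : ℝ) • u)
    rw [map_add, map_smul, hu]
    module
  · rw [hd]
    intro (v : DoubledSpace D)
    change stretchCovector c α u θ
        (tmap (DoubledSpace D) (fun p => p + c • horiz D p) (p + (t : ℝ) • u) v) = θ v -
      (stretch hc hα).fst.curvMap (p + (t : ℝ) • u)
        (vel (D := D) (fun t : unitInterval => p + (t : ℝ) • u) t) v
    rw [vel_line, curvMap_stretch, tmap_add_smul]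
    have h1 : stretchCovector c α u θ (v + c • horiz D v) =
        (1 + c) * stretchCovector c α u θ v := by
      rw [map_add, map_smul, hα.stretchCovector u hθ, smul_eq_mul]
      ring
    refine h1.trans ?_
    simp [stretchCovector, mul_inv_cancel_left₀ hc]
  · refine cotangent_ext ?_ rfl
    rw [hd]
    change p + c • horiz D p + (1 + c) • u + (t : ℝ) • (0 : DoubledSpace D) =
      p + u + (t : ℝ) • (0 : DoubledSpace D) +
        c • horiz D (p + u + (t : ℝ) • (0 : DoubledSpace D))
    rw [smul_zero, add_zero, add_zero, map_add, hu]
    module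
  · intro (v : DoubledSpace D)
    change 0 = (0 : ℝ) - (stretch hc hα).snd.curvMap _
      (vel (D := D) (fun t : unitInterval => p + u + (t : ℝ) • (0 : DoubledSpace D)) t) v
    rw [vel_line, map_zero]
    simp

theorem path_stretch (p : DoubledSpace D) : (stretch hc hα).path p =
    lineThenConst p (u := c • horiz D p) (θ := α p) (by rw [map_smul, horiz_horiz])
      (hα.apply_right p) := by
  refine DoubledCotangentPath.ext' rfl ?_
  funext t
  refine cotangent_ext ?_ rfl
  change (stretch hc hα).fst.φ 1 p + (t : ℝ) • (0 : DoubledSpace D) = _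
  rw [stretch_fst_φ_one]
  rfl

end Stretch

theorem lineThenConst_congr {p p' u u' : DoubledSpace D} {θ θ' : DoubledSpace D →L[ℝ] ℝ}
    {hu : horiz D u = u} {hθ : ∀ v, θ (horiz D v) = θ v} {hu' : horiz D u' = u'}
    {hθ' : ∀ v, θ' (horiz D v) = θ' v} (hp : p = p') (huu : u = u') (hθθ : θ = θ') :
    lineThenConst p hu hθ = lineThenConst p' hu' hθ' := by
  subst hp huu hθθ
  rfl

/-! ### Failure of self-distributivity -/

/-- The coordinate `x^i`, as a linear form. -/
def coordForm (i : Fin D) : DoubledSpace D →L[ℝ] ℝ :=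
  (EuclideanSpace.proj i).comp (ContinuousLinearMap.fst ℝ _ _)

/-- The bilinear form `dx^i ⊗ dx^j`. -/
def tensorForm (i j : Fin D) : DoubledSpace D →L[ℝ] DoubledSpace D →L[ℝ] ℝ :=
  (coordForm i).smulRight (coordForm j)

theorem tensorForm_apply (i j : Fin D) (u v : DoubledSpace D) :
    tensorForm i j u v = u.1 i * v.1 j := rfl

theorem isHorizontal_tensorForm (i j : Fin D) : IsHorizontal (tensorForm i j) :=
  fun _ _ => rfl

theorem isHorizontal_wedgeForm (i j : Fin D) : IsHorizontal (tensorForm j i - tensorForm i j) :=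
  fun _ _ => rfl

theorem isHorizontal_zero : IsHorizontal (0 : DoubledSpace D →L[ℝ] DoubledSpace D →L[ℝ] ℝ) :=
  fun _ _ => rfl

/-- In the flat space, let `Σ` fix all points and have `β = x^i dx^j`, and let `T` be the scaling
`x ↦ (1 + t) x` with zero covectors. Then `Σ ⊵ T` is the same scaling with covectors `-ω(p, ·)`,
where `ω = dx^i ∧ dx^j`, and the two sides of self-distributivity differ on a straight line. -/
theorem not_selfDistributive {i j : Fin D} (hij : i ≠ j) :
    ¬ SelfDistributive (DoubledBisection.carrier (S := flatParaHermitian D))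
      (fun σ => σ.act) := by
  intro h
  set σ := stretch (c := 0) (by norm_num) (isHorizontal_tensorForm i j) with hσ
  set τ := stretch (D := D) (c := 1) (by norm_num) isHorizontal_zero with hτ
  set υ := stretch (c := 1) (by norm_num) (isHorizontal_wedgeForm i j) with hυ
  have hcarrier : υ.carrier = σ.act '' τ.carrier := by
    have h1 : ∀ p, σ.act (τ.path p) = υ.path p := by
      intro p
      rw [hτ, path_stretch, hσ, act_lineThenConst, hυ, path_stretch]
      refine lineThenConst_congr (by simp) (by simp) ?_
      refine ContinuousLinearMap.ext fun v => ?_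
      simp only [stretchCovector, horiz, tensorForm_apply, smul_apply, sub_apply,
        ContinuousLinearMap.flip_apply, ContinuousLinearMap.prod_apply, zero_apply,
        ContinuousLinearMap.coe_fst', one_smul]
      ring
    unfold DoubledBisection.carrier
    rw [← range_comp]
    exact congrArg range (funext fun p => (h1 p).symm)
  have he : horiz D (EuclideanSpace.single i 1, 0) = (EuclideanSpace.single i 1, 0) := rfl
  have h2 := h σ τ υ hcarrier (lineThenConst 0 he (θ := 0) fun _ => rfl)
  dsimp only at h2
  rw [hτ, hσ, hυ, act_lineThenConst, act_lineThenConst, act_lineThenConst, act_lineThenConst] at h2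
  have h3 : covec _ = covec _ := congrArg (fun g => covec (g.fst 0)) h2
  -- the covectors are `-2 ω(e_i, ·)` and `(11/2) ω(e_i, ·)`, which differ on `e_j`
  have h4 := DFunLike.congr_fun h3 ((EuclideanSpace.single j 1, 0) : DoubledSpace D)
  simp [stretchCovector, lineThenConst, linePath, covec, tensorForm_apply, hij, hij.symm] at h4
  norm_num at h4

end Model

theorem mainTheorem4 :
    (∀ (D : ℕ) (M : Type*) [TopologicalSpace M] [T2Space M] [SecondCountableTopology M]
      [ChartedSpace (DoubledSpace D) M] [IsManifold 𝓘(ℝ, DoubledSpace D) ∞ M]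
      (S : ParaHermitian D M),
      IsPrecategory DoubledCotangentPath.source DoubledCotangentPath.target
        (DoubledCotangentPath.unit S) ∧
      Function.Injective (DoubledBisection.carrier (S := S)) ∧
      ∃ act : DoubledBisection S → DoubledCotangentPath S → DoubledCotangentPath S,
        IsDoubledProduct S act ∧
        IsPreRackoid D DoubledCotangentPath.source DoubledCotangentPath.target
          DoubledBisection.carrier DoubledBisection.dot act ∧
        ∀ σ τ : DoubledBisection S, ∃ υ : DoubledBisection S,
          υ.carrier = act σ '' τ.carrier ∧
          (∀ t p, υ.fst.φ t (σ.fst.φ 1 p) = σ.fst.φ 1 (τ.fst.φ t p)) ∧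
          (∀ t p, υ.snd.φ t (σ.snd.φ 1 p) = σ.snd.φ 1 (τ.snd.φ t p))) ∧
    (∀ D : ℕ, 2 ≤ D →
      ∃ (M : Type) (_ : TopologicalSpace M) (_ : T2Space M) (_ : SecondCountableTopology M)
        (_ : ChartedSpace (DoubledSpace D) M) (_ : IsManifold 𝓘(ℝ, DoubledSpace D) ∞ M)
        (S : ParaHermitian D M),
        ∀ act : DoubledBisection S → DoubledCotangentPath S → DoubledCotangentPath S,
          IsDoubledProduct S act → ¬ SelfDistributive DoubledBisection.carrier act) := by
  refine ⟨fun D M _ _ _ _ _ S => ⟨⟨fun p => ⟨DoubledCotangentPath.unit S p, rfl⟩,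
    fun p => ⟨DoubledCotangentPath.unit S p, rfl⟩, fun _ => rfl, fun _ => rfl⟩,
    DoubledBisection.carrier_injective, fun σ => σ.act, DoubledBisection.isDoubledProduct_act,
    DoubledBisection.isPreRackoid, fun σ τ => ⟨σ.image τ, σ.carrier_image τ,
      σ.image_fst_φ_conj τ, σ.image_snd_φ_conj τ⟩⟩, fun D hD => ?_⟩
  refine ⟨DoubledSpace D, inferInstance, inferInstance, inferInstance, inferInstance,
    inferInstance, flatParaHermitian D, fun act hact => ?_⟩
  rw [DoubledBisection.eq_act hact]
  exact not_selfDistributive (i := ⟨0, by omega⟩) (j := ⟨1, by omega⟩) (by simp)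

end
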